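/- **Setting.** Let $q$ be odd and let $F=\mathbb F_{q^2}$ be a field with $q^2$ elements. For a matrix $X$ over $F$ let $X^*$ be the transpose of $(x_{rs}^q)$, and let $J_m$ be the $m\times m$ matrix with ones on the second diagonal and zeros elsewhere. Put $\mathrm U(m)=\{g\in \mathrm{GL}(m,F): g^*J_mg=J_m\}$ and $\mathfrak u(m)=\{X\in\mathfrak{gl}(m,F): X^*J_m+J_mX=0\}$. For a matrix group $G$ with Lie algebra $\mathfrak g$ let $\mathcal C(\mathfrak g)$ be the real vector space of functions $\mathfrak g\to\mathbb R$ constant on the orbits of $\mathrm{Ad}(g)X=gXg^{-1}$, $g\in G$. For $P=LU\le G$ with Levi subgroup $L$, unipotent radical $U$ and Lie algebras $\mathfrak p=\mathfrak l\oplus\mathfrak n$ (where $\mathfrak n=\mathrm{Lie}\,U$), parabolic restriction $\mathcal C(\mathfrak g)\to\mathcal C(\mathfrak l)$ is $$(\downarrow\Psi)(Y)=\frac1{|\mathfrak n|}\sum_{Z\in\mathfrak n}\Psi(Y+Z),$$ and parabolic induction $\mathcal C(\mathfrak l)\to\mathcal C(\mathfrak g)$ is $$(\uparrow\Phi)(X)=\sum_{g\in[G/P]}\Phi'(\mathrm{Ad}(g^{-1})X),$$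 where $[G/P]$ is a set of representatives of the left cosets of $P$, $\Phi'(Y+Z)=\Phi(Y)$ for $Y\in\mathfrak l$, $Z\in\mathfrak n$, and $\Phi'=0$ off $\mathfrak p$. For $i+j=n$ ($i,j\ge0$) apply this to * $G=\mathrm{GL}(n,F)$ and its block upper triangular subgroup with diagonal blocks of sizes $i,j$. Here $L=\{\mathrm{diag}(A,B)\}\cong\mathrm{GL}(i,F)\times\mathrm{GL}(j,F)$, and $\mathcal C(\mathfrak l)\cong\mathcal C(\mathfrak{gl}(i,F))\otimes\mathcal C(\mathfrak{gl}(j,F))$. * $G=\mathrm U(2n)$ and its block upper triangular subgroup with diagonal blocks of sizes $i,2j,i$. Here $L=\{\mathrm{diag}(A,B,J_i(A^*)^{-1}J_i): A\in\mathrm{GL}(i,F),\ B\in\mathrm U(2j)\}$, $\mathfrak l=\{\mathrm{diag}(A,B,-J_iA^*J_i): A\in\mathfrak{gl}(i,F),\ B\in\mathfrak u(2j)\}$, and $\mathcal C(\mathfrak l)\cong\mathcal C(\mathfrak{gl}(i,F))\otimes\mathcal C(\mathfrak u(2j))$. Let $A_{q^2}=\bigoplus_{n\ge0}\mathcal C(\mathfrak{gl}(n,F))$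 and $B_{q^2}=\bigoplus_{n\ge0}\mathcal C(\mathfrak u(2n))$, with $\mathcal C(\mathfrak u(2n))$ in degree $n$. The inductions, over all $i,j\ge 0$, are the components of linear maps $\nabla:A_{q^2}\otimes A_{q^2}\to A_{q^2}$ and $\tilde\nabla:A_{q^2}\otimes B_{q^2}\to B_{q^2}$. The restrictions, summed in degree $n$ over all $i+j=n$, give linear maps $\Delta:A_{q^2}\to A_{q^2}\otimes A_{q^2}$ and $\tilde\Delta:B_{q^2}\to A_{q^2}\otimes B_{q^2}$. Let $e:\mathbb R\to A_{q^2}$ and $e^*:A_{q^2}\to\mathbb R$ be the inclusion of and the projection onto the degree $0$ part $\mathcal C(\mathfrak{gl}(0,F))=\mathbb R$. **Theorem.** The map $\tilde\nabla$ makes $B_{q^2}$ into a graded $A_{q^2}$-module and the map $\tilde\Delta$ makes it into a graded $A_{q^2}$-comodule. That is: (a) $\tilde\nabla$ and $\tilde\Delta$ preserve the grading, where $(A_{q^2}\otimes B_{q^2})_n=\bigoplus_{i+j=n}(A_{q^2})_i\otimes(B_{q^2})_j$. (b) For all $a,a'\in A_{q^2}$ and $b\in B_{q^2}$, $\tilde\nabla(\nabla(a\otimes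 a')\otimes b)=\tilde\nabla(a\otimes\tilde\nabla(a'\otimes b))$ and $\tilde\nabla(e(1)\otimes b)=b$. (c) For all $b\in B_{q^2}$, $(\Delta\otimes\mathrm{id})\tilde\Delta(b)=(\mathrm{id}\otimes\tilde\Delta)\tilde\Delta(b)$ and $(e^*\otimes\mathrm{id})\tilde\Delta(b)=b$. -/

import Mathlib

open scoped Matrix TensorProduct DirectSum

/- Invariant functions on matrix Lie algebras, parabolic induction and parabolic restriction. -/
namespace LieInv

noncomputable section

/-! ### Invariant functions -/

/-- A group of invertible `m × m` matrices over `F` together with an additive group of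
`m × m` matrices (its Lie algebra), which is stable under the adjoint action
`Ad g X = g X g⁻¹`. -/
structure LiePair (F : Type*) [Field F] (m : ℕ) where
  G : Subgroup (GL (Fin m) F)
  Lie : AddSubgroup (Matrix (Fin m) (Fin m) F)
  conj_mem : ∀ g ∈ G, ∀ X ∈ Lie,
    (g : Matrix (Fin m) (Fin m) F) * X * ((g⁻¹ : GL (Fin m) F) : Matrix (Fin m) (Fin m) F) ∈ Lie

/-- The adjoint action of `g ∈ G` on the Lie algebra. -/
def LiePair.Ad {F : Type*} [Field F] {m : ℕ} (p : LiePair F m) (g : p.G) (X : p.Lie) : p.Lie :=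
  ⟨((g : GL (Fin m) F) : Matrix (Fin m) (Fin m) F) * (X : Matrix (Fin m) (Fin m) F) *
    (((g : GL (Fin m) F)⁻¹ : GL (Fin m) F) : Matrix (Fin m) (Fin m) F),
    p.conj_mem g g.2 X X.2⟩

theorem LiePair.Ad_one {F : Type*} [Field F] {m : ℕ} (p : LiePair F m) (X : p.Lie) :
    p.Ad 1 X = X := by
  apply Subtype.ext; simp [LiePair.Ad]

theorem LiePair.Ad_mul {F : Type*} [Field F] {m : ℕ} (p : LiePair F m) (g h : p.G) (X : p.Lie) :
    p.Ad (g * h) X = p.Ad g (p.Ad h X) := by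
  apply Subtype.ext; simp only [LiePair.Ad, Subgroup.coe_mul, mul_inv_rev, Units.val_mul, mul_assoc]

/-- Two elements of the Lie algebra are equivalent if they lie in the same adjoint orbit. -/
def LiePair.orbitSetoid {F : Type*} [Field F] {m : ℕ} (p : LiePair F m) : Setoid p.Lie where
  r X Y := ∃ g : p.G, p.Ad g X = Y
  iseqv :=
    { refl := fun X => ⟨1, p.Ad_one X⟩
      symm := by
        rintro X _ ⟨g, rfl⟩
        exact ⟨g⁻¹, by rw [← p.Ad_mul, inv_mul_cancel, p.Ad_one]⟩
      trans := by
        rintro X _ _ ⟨g, rfl⟩ ⟨h, rfl⟩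
        exact ⟨h * g, p.Ad_mul h g X⟩ }

/-- `𝒞(𝔤)`: the real vector space of functions on the Lie algebra that are constant on the
orbits of the adjoint action. -/
def LiePair.C {F : Type*} [Field F] {m : ℕ} (p : LiePair F m) : Submodule ℝ (p.Lie → ℝ) where
  carrier := {f | ∀ (g : p.G) (X : p.Lie), f (p.Ad g X) = f X}
  add_mem' := by
    intro f f' hf hf' g X
    simp [hf g X, hf' g X]
  zero_mem' := by intro g X; rfl
  smul_mem' := by
    intro c f hf g X
    simp [hf g X]

/-! ### Parabolic restriction and induction -/

/-- A Levi decomposition `P = L U` of a subgroup of `G`, on the level of groups and of Lie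
algebras: `L` is the Levi subgroup with its Lie algebra, `U` the unipotent radical, `nil` the Lie
algebra of `U`. -/
structure Parabolic {F : Type*} [Field F] {m : ℕ} (p : LiePair F m) where
  L : LiePair F m
  U : Subgroup (GL (Fin m) F)
  nil : AddSubgroup (Matrix (Fin m) (Fin m) F)
  L_le : L.G ≤ p.G
  U_le : U ≤ p.G
  LieL_le : L.Lie ≤ p.Lie
  nil_le : nil ≤ p.Lie
  disj : Disjoint L.Lie nil
  L_conj_U : ∀ g ∈ L.G, ∀ u ∈ U, g * u * g⁻¹ ∈ U
  L_conj_nil : ∀ g ∈ L.G, ∀ Z ∈ nil,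
    (g : Matrix (Fin m) (Fin m) F) * Z * ((g⁻¹ : GL (Fin m) F) : Matrix (Fin m) (Fin m) F) ∈ nil
  U_conj_nil : ∀ u ∈ U, ∀ Z ∈ nil,
    (u : Matrix (Fin m) (Fin m) F) * Z * ((u⁻¹ : GL (Fin m) F) : Matrix (Fin m) (Fin m) F) ∈ nil
  U_conj_L : ∀ u ∈ U, ∀ Y ∈ L.Lie,
    (u : Matrix (Fin m) (Fin m) F) * Y * ((u⁻¹ : GL (Fin m) F) : Matrix (Fin m) (Fin m) F) - Y ∈ nil

variable {F : Type*} [Field F] {m : ℕ} {p : LiePair F m}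

/-- The parabolic subgroup `P = L U`. -/
def Parabolic.P (Q : Parabolic p) : Subgroup (GL (Fin m) F) := Q.L.G ⊔ Q.U

theorem Parabolic.mem_P (Q : Parabolic p) (g : GL (Fin m) F) :
    g ∈ Q.P ↔ ∃ l ∈ Q.L.G, ∃ u ∈ Q.U, l * u = g := by
  have h : Q.L.G ≤ Subgroup.normalizer (Q.U : Set (GL (Fin m) F)) := by
    intro l hl
    rw [Subgroup.mem_normalizer_iff]
    intro u
    refine ⟨fun hu => Q.L_conj_U l hl u hu, fun hu => ?_⟩
    have := Q.L_conj_U l⁻¹ (inv_mem hl) _ hu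
    simpa [mul_assoc] using this
  have := Subgroup.coe_mul_of_left_le_normalizer_right Q.L.G Q.U h
  rw [Parabolic.P, ← SetLike.mem_coe, this, Set.mem_mul]
  rfl

instance [Finite F] (Q : Parabolic p) : Fintype Q.nil := Fintype.ofFinite _

instance [Finite F] (Q : Parabolic p) : Fintype (p.G ⧸ Q.P.subgroupOf p.G) := Fintype.ofFinite _

/-- Parabolic restriction: the average of `Ψ` over `Y + nil`. -/
def Parabolic.res [Finite F] (Q : Parabolic p) : p.C →ₗ[ℝ] Q.L.C where
  toFun Ψ := ⟨fun Y => (Fintype.card Q.nil : ℝ)⁻¹ * ∑ Z : Q.nil,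
      (Ψ : p.Lie → ℝ) ⟨(Y : Matrix (Fin m) (Fin m) F) + (Z : Matrix (Fin m) (Fin m) F),
        add_mem (Q.LieL_le Y.2) (Q.nil_le Z.2)⟩, by
    intro g Y
    refine congrArg (fun t : ℝ => (Fintype.card Q.nil : ℝ)⁻¹ * t) ?_
    let e : Q.nil ≃ Q.nil :=
      { toFun := fun Z => ⟨_, Q.L_conj_nil g g.2 Z Z.2⟩
        invFun := fun Z => ⟨_, Q.L_conj_nil (g : GL (Fin m) F)⁻¹ (inv_mem g.2) Z Z.2⟩
        left_inv := fun Z => Subtype.ext (by simp [mul_assoc])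
        right_inv := fun Z => Subtype.ext (by simp [mul_assoc]) }
    rw [← e.sum_comp]
    refine Finset.sum_congr rfl fun Z _ => ?_
    refine Eq.trans (congrArg (Ψ : p.Lie → ℝ) ?_) (Ψ.2 ⟨g, Q.L_le g.2⟩ _)
    apply Subtype.ext
    simp [LiePair.Ad, e, mul_add, add_mul]⟩
  map_add' Ψ Ψ' := by
    apply Subtype.ext; funext Y
    simp [Finset.sum_add_distrib, mul_add]
  map_smul' c Ψ := by
    apply Subtype.ext; funext Y
    simp only [Submodule.coe_smul, Pi.smul_apply, smul_eq_mul, RingHom.id_apply,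
      ← Finset.mul_sum]
    ring

open scoped Classical in
/-- The function `Φ'` on the Lie algebra of `G`: if `W = Y + Z` with `Y` in the Lie algebra of `L`
and `Z` in that of `U`, then `Φ'(W) = Φ(Y)`; and `Φ'(W) = 0` if there is no such
decomposition. -/
def Parabolic.extend (Q : Parabolic p) (Φ : Q.L.Lie → ℝ) (W : p.Lie) : ℝ :=
  if h : ∃ Y : Q.L.Lie, (W : Matrix (Fin m) (Fin m) F) - (Y : Matrix (Fin m) (Fin m) F) ∈ Q.nil
  then Φ h.choose else 0

theorem Parabolic.extend_eq (Q : Parabolic p) (Φ : Q.L.Lie → ℝ) (W : p.Lie) (Y : Q.L.Lie)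
    (h : (W : Matrix (Fin m) (Fin m) F) - (Y : Matrix (Fin m) (Fin m) F) ∈ Q.nil) :
    Q.extend Φ W = Φ Y := by
  have h' : ∃ Y : Q.L.Lie,
      (W : Matrix (Fin m) (Fin m) F) - (Y : Matrix (Fin m) (Fin m) F) ∈ Q.nil := ⟨Y, h⟩
  rw [Parabolic.extend, dif_pos h']
  congr 1
  apply Subtype.ext
  rw [← sub_eq_zero]
  have h1 := sub_mem h h'.choose_spec
  rw [sub_sub_sub_cancel_left] at h1
  exact (AddSubgroup.disjoint_def.mp Q.disj) (sub_mem h'.choose.2 Y.2) h1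

theorem Parabolic.extend_eq_zero (Q : Parabolic p) (Φ : Q.L.Lie → ℝ) (W : p.Lie)
    (h : ¬ ∃ Y : Q.L.Lie,
      (W : Matrix (Fin m) (Fin m) F) - (Y : Matrix (Fin m) (Fin m) F) ∈ Q.nil) :
    Q.extend Φ W = 0 := by
  rw [Parabolic.extend, dif_neg h]

theorem Parabolic.conj_decomp (Q : Parabolic p) (l u : GL (Fin m) F) (hl : l ∈ Q.L.G)
    (hu : u ∈ Q.U) (W : Matrix (Fin m) (Fin m) F) (Y : Q.L.Lie)
    (h : W - (Y : Matrix (Fin m) (Fin m) F) ∈ Q.nil) :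
    ((l * u : GL (Fin m) F) : Matrix (Fin m) (Fin m) F) * W *
      (((l * u)⁻¹ : GL (Fin m) F) : Matrix (Fin m) (Fin m) F) -
      (Q.L.Ad ⟨l, hl⟩ Y : Matrix (Fin m) (Fin m) F) ∈ Q.nil := by
  have h1 := add_mem (Q.U_conj_nil u hu _ h) (Q.U_conj_L u hu Y Y.2)
  have h2 := Q.L_conj_nil l hl _ h1
  convert h2 using 1
  simp only [LiePair.Ad, mul_inv_rev, Units.val_mul]
  noncomm_ring

theorem Parabolic.extend_Ad (Q : Parabolic p) (Φ : Q.L.C) (W : p.Lie) (g : p.G)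
    (hg : (g : GL (Fin m) F) ∈ Q.P) :
    Q.extend Φ (p.Ad g W) = Q.extend Φ W := by
  have key : ∀ (g : p.G), (g : GL (Fin m) F) ∈ Q.P → ∀ (W : p.Lie) (Y : Q.L.Lie),
      (W : Matrix (Fin m) (Fin m) F) - (Y : Matrix (Fin m) (Fin m) F) ∈ Q.nil →
      ∃ Y' : Q.L.Lie, ((p.Ad g W : p.Lie) : Matrix (Fin m) (Fin m) F) -
        (Y' : Matrix (Fin m) (Fin m) F) ∈ Q.nil ∧ (Φ : Q.L.Lie → ℝ) Y' = (Φ : Q.L.Lie → ℝ) Y := by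
    intro g hg W Y h
    obtain ⟨l, hl, u, hu, hlu⟩ := (Q.mem_P _).mp hg
    refine ⟨Q.L.Ad ⟨l, hl⟩ Y, ?_, Φ.2 _ _⟩
    have := Q.conj_decomp l u hl hu W Y h
    rw [hlu] at this
    exact this
  by_cases h : ∃ Y : Q.L.Lie,
      (W : Matrix (Fin m) (Fin m) F) - (Y : Matrix (Fin m) (Fin m) F) ∈ Q.nil
  · obtain ⟨Y, hY⟩ := h
    obtain ⟨Y', hY', he⟩ := key g hg W Y hY
    rw [Q.extend_eq _ _ Y hY, Q.extend_eq _ _ Y' hY', he]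
  · rw [Q.extend_eq_zero _ _ h, Q.extend_eq_zero]
    rintro ⟨Y, hY⟩
    obtain ⟨Y', hY', -⟩ := key g⁻¹ (by simpa using hg) _ Y hY
    rw [← p.Ad_mul, inv_mul_cancel, p.Ad_one] at hY'
    exact h ⟨Y', hY'⟩

theorem Parabolic.extend_out (Q : Parabolic p) (Φ : Q.L.C) (X : p.Lie) (g : p.G) :
    Q.extend Φ (p.Ad (Quotient.out (QuotientGroup.mk g : p.G ⧸ Q.P.subgroupOf p.G))⁻¹ X) =
      Q.extend Φ (p.Ad g⁻¹ X) := by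
  obtain ⟨h, hh⟩ := QuotientGroup.mk_out_eq_mul (Q.P.subgroupOf p.G) g
  rw [hh, mul_inv_rev, p.Ad_mul]
  apply Q.extend_Ad
  exact inv_mem (Subgroup.mem_subgroupOf.mp h.2)

/-- Parabolic induction: the sum of `Φ'(Ad(g⁻¹) X)` over a set of representatives `g` of the left
cosets of `G` modulo `P`. -/
def Parabolic.ind [Finite F] (Q : Parabolic p) : Q.L.C →ₗ[ℝ] p.C where
  toFun Φ := ⟨fun X => ∑ c : p.G ⧸ Q.P.subgroupOf p.G, Q.extend Φ (p.Ad (Quotient.out c)⁻¹ X), by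
    intro k X
    beta_reduce
    rw [← Equiv.sum_comp (MulAction.toPerm k : Equiv.Perm (p.G ⧸ Q.P.subgroupOf p.G))]
    refine Finset.sum_congr rfl fun c _ => ?_
    induction c using QuotientGroup.induction_on with
    | H g =>
      have : MulAction.toPerm k (QuotientGroup.mk g : p.G ⧸ Q.P.subgroupOf p.G) =
        QuotientGroup.mk (k * g) := rfl
      rw [this, Q.extend_out, Q.extend_out, ← p.Ad_mul]
      simp⟩
  map_add' Φ Φ' := by
    apply Subtype.ext; funext X
    simp only [Submodule.coe_add, Pi.add_apply, ← Finset.sum_add_distrib]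
    refine Finset.sum_congr rfl fun c _ => ?_
    simp only [Parabolic.extend]
    split_ifs <;> simp
  map_smul' r Φ := by
    apply Subtype.ext; funext X
    simp only [Submodule.coe_smul, Pi.smul_apply, smul_eq_mul, RingHom.id_apply, Finset.mul_sum]
    refine Finset.sum_congr rfl fun c _ => ?_
    simp only [Parabolic.extend]
    split_ifs <;> simp

/-! ### Functions on products -/

/-- The indicator function of an adjoint orbit. -/
def LiePair.chi {F : Type*} [Field F] {m : ℕ} (p : LiePair F m) (O : Quotient p.orbitSetoid) :
    p.C := by
  classical
  exact ⟨fun X => if Quotient.mk p.orbitSetoid X = O then 1 else 0, by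
    intro g X
    have : Quotient.mk p.orbitSetoid (p.Ad g X) = Quotient.mk p.orbitSetoid X :=
      (Quotient.sound (s := p.orbitSetoid) ⟨g, rfl⟩).symm
    simp only [this]⟩

theorem LiePair.C_out {F : Type*} [Field F] {m : ℕ} (p : LiePair F m) (φ : p.C) (X : p.Lie) :
    (φ : p.Lie → ℝ) (Quotient.mk p.orbitSetoid X).out = (φ : p.Lie → ℝ) X := by
  obtain ⟨g, hg⟩ := (Quotient.exact (Quotient.out_eq (Quotient.mk p.orbitSetoid X)) :
    p.orbitSetoid (Quotient.mk p.orbitSetoid X).out X)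
  have := φ.2 g (Quotient.mk p.orbitSetoid X).out
  rw [hg] at this
  exact this.symm

instance {F : Type*} [Field F] [Finite F] {m : ℕ} (p : LiePair F m) :
    Fintype (Quotient p.orbitSetoid) := Fintype.ofFinite _

theorem LiePair.sum_chi {F : Type*} [Field F] [Finite F] {m : ℕ} (p : LiePair F m) (φ : p.C) :
    ∑ O : Quotient p.orbitSetoid, (φ : p.Lie → ℝ) O.out • p.chi O = φ := by
  classical
  apply Subtype.ext; funext X
  simp [LiePair.chi, Finset.sum_apply, p.C_out]

variable {m₁ m₂ : ℕ}

/-- The external product: `φ ⊗ ψ` is sent to the function `(X, Y) ↦ φ(X) ψ(Y)`. -/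
def box (p₁ : LiePair F m₁) (p₂ : LiePair F m₂) (p : LiePair F m)
    (e : p₁.Lie × p₂.Lie ≃ p.Lie)
    (h : ∀ g : p.G, ∃ (g₁ : p₁.G) (g₂ : p₂.G), ∀ X Y,
      p.Ad g (e (X, Y)) = e (p₁.Ad g₁ X, p₂.Ad g₂ Y)) :
    p₁.C ⊗[ℝ] p₂.C →ₗ[ℝ] p.C :=
  TensorProduct.lift <| LinearMap.mk₂ ℝ
    (fun φ ψ => ⟨fun W => (φ : p₁.Lie → ℝ) (e.symm W).1 * (ψ : p₂.Lie → ℝ) (e.symm W).2, by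
      intro g W
      obtain ⟨g₁, g₂, h⟩ := h g
      obtain ⟨⟨X, Y⟩, rfl⟩ := e.surjective W
      simp [h, φ.2 g₁ X, ψ.2 g₂ Y]⟩)
    (fun φ φ' ψ => by apply Subtype.ext; funext W; simp [add_mul])
    (fun c φ ψ => by apply Subtype.ext; funext W; simp [mul_assoc])
    (fun φ ψ ψ' => by apply Subtype.ext; funext W; simp [mul_add])
    (fun c φ ψ => by apply Subtype.ext; funext W; simp [mul_left_comm])

/-- The external product is an isomorphism `𝒞(𝔤₁) ⊗ 𝒞(𝔤₂) ≃ 𝒞(𝔤)` whenever `e` identifies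
`𝔤₁ × 𝔤₂` with `𝔤` compatibly with the adjoint actions of `G₁ × G₂` and `G`. -/
def boxEquiv [Finite F] (p₁ : LiePair F m₁) (p₂ : LiePair F m₂) (p : LiePair F m)
    (e : p₁.Lie × p₂.Lie ≃ p.Lie)
    (h : ∀ g : p.G, ∃ (g₁ : p₁.G) (g₂ : p₂.G), ∀ X Y,
      p.Ad g (e (X, Y)) = e (p₁.Ad g₁ X, p₂.Ad g₂ Y))
    (h' : ∀ (g₁ : p₁.G) (g₂ : p₂.G), ∃ g : p.G, ∀ X Y,
      p.Ad g (e (X, Y)) = e (p₁.Ad g₁ X, p₂.Ad g₂ Y)) :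
    p₁.C ⊗[ℝ] p₂.C ≃ₗ[ℝ] p.C :=
  LinearEquiv.ofLinearMap (box p₁ p₂ p e h)
    { toFun := fun Ψ => ∑ O₁ : Quotient p₁.orbitSetoid, ∑ O₂ : Quotient p₂.orbitSetoid,
        (Ψ : p.Lie → ℝ) (e (O₁.out, O₂.out)) • (p₁.chi O₁ ⊗ₜ[ℝ] p₂.chi O₂)
      map_add' := fun Ψ Ψ' => by simp [add_smul, Finset.sum_add_distrib]
      map_smul' := fun c Ψ => by simp [mul_smul, Finset.smul_sum] }
    (by
      classical
      ext Ψ W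
      obtain ⟨⟨X, Y⟩, rfl⟩ := e.surjective W
      have hx : ∀ (X : p₁.Lie) (Y : p₂.Lie),
          (Ψ : p.Lie → ℝ) (e ((Quotient.mk p₁.orbitSetoid X).out,
            (Quotient.mk p₂.orbitSetoid Y).out)) = (Ψ : p.Lie → ℝ) (e (X, Y)) := by
        intro X Y
        obtain ⟨g₁, hg₁⟩ := (Quotient.exact (Quotient.out_eq (Quotient.mk p₁.orbitSetoid X)) :
          p₁.orbitSetoid (Quotient.mk p₁.orbitSetoid X).out X)
        obtain ⟨g₂, hg₂⟩ := (Quotient.exact (Quotient.out_eq (Quotient.mk p₂.orbitSetoid Y)) :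
          p₂.orbitSetoid (Quotient.mk p₂.orbitSetoid Y).out Y)
        obtain ⟨g, hg⟩ := h' g₁ g₂
        rw [← Ψ.2 g, hg, hg₁, hg₂]
      simp [box, LiePair.chi, Finset.sum_apply, hx])
    (by
      apply TensorProduct.ext'
      intro φ ψ
      conv_rhs => rw [LinearMap.id_apply, ← p₁.sum_chi φ, ← p₂.sum_chi ψ]
      simp only [TensorProduct.sum_tmul, TensorProduct.tmul_sum, TensorProduct.smul_tmul_smul]
      simp only [box, TensorProduct.lift.tmul, LinearMap.mk₂_apply, LinearMap.coe_comp,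
        Function.comp_apply, LinearMap.coe_mk, AddHom.coe_mk, Equiv.symm_apply_apply]
      first | rfl | exact Finset.sum_comm)

theorem boxEquiv_tmul [Finite F] (p₁ : LiePair F m₁) (p₂ : LiePair F m₂) (p : LiePair F m)
    (e : p₁.Lie × p₂.Lie ≃ p.Lie)
    (h : ∀ g : p.G, ∃ (g₁ : p₁.G) (g₂ : p₂.G), ∀ X Y,
      p.Ad g (e (X, Y)) = e (p₁.Ad g₁ X, p₂.Ad g₂ Y))
    (h' : ∀ (g₁ : p₁.G) (g₂ : p₂.G), ∃ g : p.G, ∀ X Y,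
      p.Ad g (e (X, Y)) = e (p₁.Ad g₁ X, p₂.Ad g₂ Y))
    (φ : p₁.C) (ψ : p₂.C) (X : p₁.Lie) (Y : p₂.Lie) :
    (boxEquiv p₁ p₂ p e h h' (φ ⊗ₜ ψ) : p.Lie → ℝ) (e (X, Y)) =
      (φ : p₁.Lie → ℝ) X * (ψ : p₂.Lie → ℝ) Y := by
  simp [boxEquiv, box]

/-! ### General linear groups -/

/-- `GL(n, F)` and its Lie algebra `𝔤𝔩(n, F)` of all matrices. -/
def glPair (F : Type*) [Field F] (n : ℕ) : LiePair F n where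
  G := ⊤
  Lie := ⊤
  conj_mem := fun _ _ _ _ => trivial

variable {i j n : ℕ}

/-- The order-preserving splitting of `n = i + j` indices into blocks of sizes `i`, `j`. -/
def split₂ (h : i + j = n) : Fin i ⊕ Fin j ≃ Fin n := finSumFinEquiv.trans (finCongr h)

/-- The `n × n` block matrix with rows `(A, C)`, `(0, B)`. -/
def up₂ (h : i + j = n) (A : Matrix (Fin i) (Fin i) F) (C : Matrix (Fin i) (Fin j) F)
    (B : Matrix (Fin j) (Fin j) F) : Matrix (Fin n) (Fin n) F :=
  Matrix.reindex (split₂ h) (split₂ h) (Matrix.fromBlocks A C 0 B)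

theorem up₂_mul (h : i + j = n) (A A' : Matrix (Fin i) (Fin i) F) (C C' : Matrix (Fin i) (Fin j) F)
    (B B' : Matrix (Fin j) (Fin j) F) :
    up₂ h A C B * up₂ h A' C' B' = up₂ h (A * A') (A * C' + C * B') (B * B') := by
  simp [up₂, Matrix.submatrix_mul_equiv, Matrix.fromBlocks_multiply]

theorem up₂_one (h : i + j = n) : up₂ h (1 : Matrix (Fin i) (Fin i) F) 0 1 = 1 := by
  simp [up₂]

theorem up₂_zero (h : i + j = n) : up₂ h (0 : Matrix (Fin i) (Fin i) F) 0 0 = 0 := by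
  simp [up₂]

theorem up₂_add (h : i + j = n) (A A' : Matrix (Fin i) (Fin i) F) (C C' : Matrix (Fin i) (Fin j) F)
    (B B' : Matrix (Fin j) (Fin j) F) :
    up₂ h A C B + up₂ h A' C' B' = up₂ h (A + A') (C + C') (B + B') := by
  have : Matrix.fromBlocks (A + A') (C + C') 0 (B + B') =
      Matrix.fromBlocks A C 0 B + Matrix.fromBlocks A' C' 0 B' := by
    simp [Matrix.fromBlocks_add]
  simp [up₂, this, Matrix.submatrix_add]

theorem up₂_neg (h : i + j = n) (A : Matrix (Fin i) (Fin i) F) (C : Matrix (Fin i) (Fin j) F)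
    (B : Matrix (Fin j) (Fin j) F) : -up₂ h A C B = up₂ h (-A) (-C) (-B) := by
  have : Matrix.fromBlocks (-A) (-C) 0 (-B) = -Matrix.fromBlocks A C 0 B := by
    simp [Matrix.fromBlocks_neg]
  simp [up₂, this, Matrix.submatrix_neg]

theorem up₂_inj (h : i + j = n) {A A' : Matrix (Fin i) (Fin i) F} {C C' : Matrix (Fin i) (Fin j) F}
    {B B' : Matrix (Fin j) (Fin j) F} (he : up₂ h A C B = up₂ h A' C' B') :
    A = A' ∧ C = C' ∧ B = B' := by
  have := (Matrix.reindex (split₂ h) (split₂ h)).injective he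
  rw [Matrix.fromBlocks_inj] at this
  exact ⟨this.1, this.2.1, this.2.2.2⟩

theorem up₂_inv (h : i + j = n) {g : GL (Fin n) F} {A : GL (Fin i) F} {B : GL (Fin j) F}
    (hg : (g : Matrix (Fin n) (Fin n) F) = up₂ h A 0 B) :
    ((g⁻¹ : GL (Fin n) F) : Matrix (Fin n) (Fin n) F) =
      up₂ h (A⁻¹ : GL (Fin i) F) 0 (B⁻¹ : GL (Fin j) F) := by
  apply Units.inv_eq_of_mul_eq_one_right
  rw [hg, up₂_mul, ← up₂_one h]
  simp

theorem up₂_unip_inv (h : i + j = n) {g : GL (Fin n) F} {C : Matrix (Fin i) (Fin j) F}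
    (hg : (g : Matrix (Fin n) (Fin n) F) = up₂ h 1 C 1) :
    ((g⁻¹ : GL (Fin n) F) : Matrix (Fin n) (Fin n) F) = up₂ h 1 (-C) 1 := by
  apply Units.inv_eq_of_mul_eq_one_right
  rw [hg, up₂_mul, ← up₂_one h]
  simp

theorem exists_up₂ (h : i + j = n) (A : GL (Fin i) F) (B : GL (Fin j) F) :
    ∃ g : GL (Fin n) F, (g : Matrix (Fin n) (Fin n) F) = up₂ h A 0 B :=
  ⟨⟨up₂ h A 0 B, up₂ h (A⁻¹ : GL (Fin i) F) 0 (B⁻¹ : GL (Fin j) F),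
    by rw [up₂_mul, ← up₂_one h]; simp, by rw [up₂_mul, ← up₂_one h]; simp⟩, rfl⟩

/-- The block diagonal subgroup `GL(i, F) × GL(j, F)` of `GL(n, F)`, and its Lie algebra. -/
def glLevi (F : Type*) [Field F] {i j n : ℕ} (h : i + j = n) : LiePair F n where
  G :=
    { carrier := {g | ∃ (A : GL (Fin i) F) (B : GL (Fin j) F),
        (g : Matrix (Fin n) (Fin n) F) = up₂ h A 0 B}
      mul_mem' := by
        rintro g g' ⟨A, B, hg⟩ ⟨A', B', hg'⟩
        exact ⟨A * A', B * B', by rw [Units.val_mul, hg, hg', up₂_mul]; simp⟩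
      one_mem' := ⟨1, 1, by simp [up₂_one]⟩
      inv_mem' := by
        rintro g ⟨A, B, hg⟩
        exact ⟨A⁻¹, B⁻¹, up₂_inv h hg⟩ }
  Lie :=
    { carrier := {X | ∃ (A : Matrix (Fin i) (Fin i) F) (B : Matrix (Fin j) (Fin j) F),
        X = up₂ h A 0 B}
      add_mem' := by
        rintro _ _ ⟨A, B, rfl⟩ ⟨A', B', rfl⟩
        exact ⟨A + A', B + B', by rw [up₂_add]; simp⟩
      zero_mem' := ⟨0, 0, (up₂_zero h).symm⟩
      neg_mem' := by
        rintro _ ⟨A, B, rfl⟩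
        exact ⟨-A, -B, by rw [up₂_neg]; simp⟩ }
  conj_mem := by
    rintro g ⟨A, B, hg⟩ _ ⟨X, Y, rfl⟩
    exact ⟨A * X * (A⁻¹ : GL (Fin i) F), B * Y * (B⁻¹ : GL (Fin j) F), by
      rw [up₂_inv h hg, hg, up₂_mul, up₂_mul]; simp⟩

/-- The Levi decomposition of the block upper triangular subgroup of `GL(n, F)` with blocks of
sizes `i`, `j`. -/
def glParabolic (F : Type*) [Field F] {i j n : ℕ} (h : i + j = n) : Parabolic (glPair F n) where
  L := glLevi F h
  U :=
    { carrier := {g | ∃ C : Matrix (Fin i) (Fin j) F,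
        (g : Matrix (Fin n) (Fin n) F) = up₂ h 1 C 1}
      mul_mem' := by
        rintro g g' ⟨C, hg⟩ ⟨C', hg'⟩
        exact ⟨C' + C, by rw [Units.val_mul, hg, hg', up₂_mul]; simp⟩
      one_mem' := ⟨0, by simp [up₂_one]⟩
      inv_mem' := by
        rintro g ⟨C, hg⟩
        exact ⟨-C, up₂_unip_inv h hg⟩ }
  nil :=
    { carrier := {X | ∃ C : Matrix (Fin i) (Fin j) F, X = up₂ h 0 C 0}
      add_mem' := by
        rintro _ _ ⟨C, rfl⟩ ⟨C', rfl⟩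
        exact ⟨C + C', by rw [up₂_add]; simp⟩
      zero_mem' := ⟨0, (up₂_zero h).symm⟩
      neg_mem' := by
        rintro _ ⟨C, rfl⟩
        exact ⟨-C, by rw [up₂_neg]; simp⟩ }
  L_le := le_top
  U_le := le_top
  LieL_le := le_top
  nil_le := le_top
  disj := by
    rw [AddSubgroup.disjoint_def]
    rintro _ ⟨A, B, rfl⟩ ⟨C, hC⟩
    obtain ⟨rfl, -, rfl⟩ := up₂_inj h hC
    exact up₂_zero h
  L_conj_U := by
    rintro g ⟨A, B, hg⟩ u ⟨C, hu⟩
    exact ⟨(A : Matrix (Fin i) (Fin i) F) * C *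
      ((B⁻¹ : GL (Fin j) F) : Matrix (Fin j) (Fin j) F), by
      rw [Units.val_mul, Units.val_mul, up₂_inv h hg, hg, hu, up₂_mul, up₂_mul]; simp⟩
  L_conj_nil := by
    rintro g ⟨A, B, hg⟩ _ ⟨C, rfl⟩
    exact ⟨(A : Matrix (Fin i) (Fin i) F) * C *
      ((B⁻¹ : GL (Fin j) F) : Matrix (Fin j) (Fin j) F), by
      rw [up₂_inv h hg, hg, up₂_mul, up₂_mul]; simp⟩
  U_conj_nil := by
    rintro u ⟨C, hu⟩ _ ⟨Z, rfl⟩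
    exact ⟨Z, by rw [up₂_unip_inv h hu, hu, up₂_mul, up₂_mul]; simp⟩
  U_conj_L := by
    rintro u ⟨C, hu⟩ _ ⟨A, B, rfl⟩
    exact ⟨-(A * C) + C * B, by
      rw [up₂_unip_inv h hu, hu, up₂_mul, up₂_mul, sub_eq_add_neg, up₂_neg, up₂_add]; simp⟩

/-- The identification of `𝔤𝔩(i, F) × 𝔤𝔩(j, F)` with block diagonal matrices. -/
def glBlock (F : Type*) [Field F] {i j n : ℕ} (h : i + j = n) :
    (glPair F i).Lie × (glPair F j).Lie ≃ (glLevi F h).Lie :=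
  Equiv.ofBijective (fun X => ⟨up₂ h X.1 0 X.2, X.1, X.2, rfl⟩) (by
    constructor
    · rintro ⟨X, Y⟩ ⟨X', Y'⟩ he
      obtain ⟨h1, -, h2⟩ := up₂_inj h (congrArg Subtype.val he)
      exact Prod.ext (Subtype.ext h1) (Subtype.ext h2)
    · rintro ⟨_, A, B, rfl⟩
      exact ⟨(⟨A, trivial⟩, ⟨B, trivial⟩), rfl⟩)

theorem glBlock_apply (F : Type*) [Field F] {i j n : ℕ} (h : i + j = n)
    (X : (glPair F i).Lie) (Y : (glPair F j).Lie) :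
    (glBlock F h (X, Y) : Matrix (Fin n) (Fin n) F) = up₂ h X 0 Y := rfl

/-- The identification of `𝒞(𝔤𝔩(i)) ⊗ 𝒞(𝔤𝔩(j))` with the invariant functions on the Levi
subalgebra. -/
def glTensor (F : Type*) [Field F] [Finite F] {i j n : ℕ} (h : i + j = n) :
    (glPair F i).C ⊗[ℝ] (glPair F j).C ≃ₗ[ℝ] (glLevi F h).C :=
  boxEquiv (glPair F i) (glPair F j) (glLevi F h) (glBlock F h)
    (by
      rintro ⟨g, A, B, hg⟩
      refine ⟨⟨A, trivial⟩, ⟨B, trivial⟩, fun X Y => Subtype.ext ?_⟩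
      simp [LiePair.Ad, hg, glBlock_apply, up₂_inv h hg, up₂_mul])
    (by
      rintro ⟨A, hA⟩ ⟨B, hB⟩
      obtain ⟨g, hg⟩ := exists_up₂ h A B
      refine ⟨⟨g, A, B, hg⟩, fun X Y => Subtype.ext ?_⟩
      simp [LiePair.Ad, hg, glBlock_apply, up₂_inv h hg, up₂_mul])

/-! ### Unitary groups -/

/-- The `m × m` matrix with ones on the second diagonal and zeros elsewhere. -/
def J (F : Type*) [Field F] (m : ℕ) : Matrix (Fin m) (Fin m) F :=
  Matrix.of fun r c => if c = r.rev then 1 else 0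

theorem J_mul_J (F : Type*) [Field F] (m : ℕ) : J F m * J F m = 1 := by
  ext r c
  simp only [J, Matrix.mul_apply, Matrix.one_apply, Matrix.of_apply, ite_mul, one_mul, zero_mul,
    Finset.sum_ite_eq', Finset.mem_univ, if_true, Fin.rev_rev, eq_comm]

theorem J_conjTranspose (F : Type*) [Field F] [StarRing F] (m : ℕ) : (J F m)ᴴ = J F m := by
  ext r c
  simp only [J, Matrix.conjTranspose_apply, Matrix.of_apply]
  have : r = c.rev ↔ c = r.rev := ⟨fun h => by rw [h, Fin.rev_rev], fun h => by rw [h, Fin.rev_rev]⟩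
  simp only [this]
  split_ifs <;> simp

/-- The unitary group `{g | g* J g = J}` and its Lie algebra `{X | X* J + J X = 0}`, where `X*` is
the conjugate transpose. -/
def uPair (F : Type*) [Field F] [StarRing F] (m : ℕ) : LiePair F m where
  G :=
    { carrier := {g | (g : Matrix (Fin m) (Fin m) F)ᴴ * J F m * (g : Matrix (Fin m) (Fin m) F) =
        J F m}
      mul_mem' := by
        intro g g' hg hg'
        simp only [Set.mem_ofPred_eq] at hg hg' ⊢
        rw [Units.val_mul, Matrix.conjTranspose_mul]
        calc _ = (g' : Matrix (Fin m) (Fin m) F)ᴴ *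
              ((g : Matrix (Fin m) (Fin m) F)ᴴ * J F m * (g : Matrix (Fin m) (Fin m) F)) *
              (g' : Matrix (Fin m) (Fin m) F) := by simp only [mul_assoc]
          _ = _ := by rw [hg, hg']
      one_mem' := by simp
      inv_mem' := by
        intro g hg
        simp only [Set.mem_ofPred_eq] at hg ⊢
        conv_lhs => rw [← hg]
        have h1 : ((g⁻¹ : GL (Fin m) F) : Matrix (Fin m) (Fin m) F)ᴴ *
            (g : Matrix (Fin m) (Fin m) F)ᴴ = 1 := by
          rw [← Matrix.conjTranspose_mul, ← Units.val_mul]; simp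
        have h2 : (g : Matrix (Fin m) (Fin m) F) *
            ((g⁻¹ : GL (Fin m) F) : Matrix (Fin m) (Fin m) F) = 1 := by
          rw [← Units.val_mul]; simp
        simp only [← mul_assoc]
        rw [h1, one_mul, mul_assoc, h2, mul_one] }
  Lie :=
    { carrier := {X | Xᴴ * J F m + J F m * X = 0}
      add_mem' := by
        intro X Y hX hY
        simp only [Set.mem_ofPred_eq] at hX hY ⊢
        rw [Matrix.conjTranspose_add, add_mul, mul_add, add_add_add_comm, hX, hY, add_zero]
      zero_mem' := by simp
      neg_mem' := by
        intro X hX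
        simp only [Set.mem_ofPred_eq] at hX ⊢
        rw [Matrix.conjTranspose_neg, neg_mul, mul_neg, ← neg_add, hX, neg_zero] }
  conj_mem := by
    intro g hg X hX
    change (g : Matrix (Fin m) (Fin m) F)ᴴ * J F m * (g : Matrix (Fin m) (Fin m) F) = J F m at hg
    change Xᴴ * J F m + J F m * X = 0 at hX
    change (_ : Matrix (Fin m) (Fin m) F)ᴴ * J F m + J F m * _ = 0
    set a := (g : Matrix (Fin m) (Fin m) F)
    set b := ((g⁻¹ : GL (Fin m) F) : Matrix (Fin m) (Fin m) F)
    have hab : a * b = 1 := by simp only [a, b]; rw [← Units.val_mul]; simp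
    have hba : bᴴ * aᴴ = 1 := by rw [← Matrix.conjTranspose_mul, hab]; simp
    have h1 : J F m * a = bᴴ * J F m := by
      conv_rhs => rw [← hg]
      simp only [← mul_assoc]
      rw [hba, one_mul]
    have h2 : aᴴ * J F m = J F m * b := by
      conv_rhs => rw [← hg]
      simp only [mul_assoc]
      rw [hab, mul_one]
    calc (a * X * b)ᴴ * J F m + J F m * (a * X * b)
        = bᴴ * Xᴴ * (aᴴ * J F m) + (J F m * a) * X * b := by
          simp only [Matrix.conjTranspose_mul, mul_assoc]
      _ = bᴴ * (Xᴴ * J F m + J F m * X) * b := by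
          rw [h1, h2]; simp only [mul_add, add_mul, mul_assoc]
      _ = 0 := by rw [hX]; simp

/-- The order-preserving splitting of `2n = i + 2j + i` indices into blocks of sizes `i`, `2j`,
`i`. -/
def split₃ (h : i + j = n) : Fin i ⊕ (Fin (2 * j) ⊕ Fin i) ≃ Fin (2 * n) :=
  ((Equiv.refl (Fin i)).sumCongr finSumFinEquiv).trans
    (finSumFinEquiv.trans (finCongr (by omega)))

/-- The `2n × 2n` block matrix with rows `(A, C, D)`, `(0, B, C')`, `(0, 0, E)`. -/
def up₃ (h : i + j = n) (A : Matrix (Fin i) (Fin i) F) (C : Matrix (Fin i) (Fin (2 * j)) F)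
    (D : Matrix (Fin i) (Fin i) F) (B : Matrix (Fin (2 * j)) (Fin (2 * j)) F)
    (C' : Matrix (Fin (2 * j)) (Fin i) F) (E : Matrix (Fin i) (Fin i) F) :
    Matrix (Fin (2 * n)) (Fin (2 * n)) F :=
  Matrix.reindex (split₃ h) (split₃ h)
    (Matrix.fromBlocks A (Matrix.fromCols C D) 0 (Matrix.fromBlocks B C' 0 E))

section up₃

variable (h : i + j = n) {A A₁ : Matrix (Fin i) (Fin i) F} {C C₁ : Matrix (Fin i) (Fin (2 * j)) F}
  {D D₁ : Matrix (Fin i) (Fin i) F} {B B₁ : Matrix (Fin (2 * j)) (Fin (2 * j)) F}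
  {C' C'₁ : Matrix (Fin (2 * j)) (Fin i) F} {E E₁ : Matrix (Fin i) (Fin i) F}

theorem up₃_mul : up₃ h A C D B C' E * up₃ h A₁ C₁ D₁ B₁ C'₁ E₁ =
    up₃ h (A * A₁) (A * C₁ + C * B₁) (A * D₁ + C * C'₁ + D * E₁) (B * B₁) (B * C'₁ + C' * E₁)
      (E * E₁) := by
  simp only [up₃, Matrix.reindex_apply, Matrix.submatrix_mul_equiv, Matrix.fromBlocks_multiply]
  congr 2
  · simp
  · ext a (b | b) <;> simp [Matrix.mul_apply, Fintype.sum_sum_type, add_assoc]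
  · simp
  · simp

theorem up₃_one : up₃ h (1 : Matrix (Fin i) (Fin i) F) 0 0 1 0 1 = 1 := by
  simp [up₃]

theorem up₃_zero : up₃ h (0 : Matrix (Fin i) (Fin i) F) 0 0 0 0 0 = 0 := by
  simp [up₃]

theorem up₃_add : up₃ h A C D B C' E + up₃ h A₁ C₁ D₁ B₁ C'₁ E₁ =
    up₃ h (A + A₁) (C + C₁) (D + D₁) (B + B₁) (C' + C'₁) (E + E₁) := by
  ext r c
  obtain ⟨r, rfl⟩ := (split₃ h).surjective r
  obtain ⟨c, rfl⟩ := (split₃ h).surjective c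
  rcases r with (r | r | r) <;> rcases c with (c | c | c) <;> simp [up₃]

theorem up₃_neg : -up₃ h A C D B C' E = up₃ h (-A) (-C) (-D) (-B) (-C') (-E) := by
  ext r c
  obtain ⟨r, rfl⟩ := (split₃ h).surjective r
  obtain ⟨c, rfl⟩ := (split₃ h).surjective c
  rcases r with (r | r | r) <;> rcases c with (c | c | c) <;> simp [up₃]

theorem up₃_inj (he : up₃ h A C D B C' E = up₃ h A₁ C₁ D₁ B₁ C'₁ E₁) :
    A = A₁ ∧ B = B₁ ∧ E = E₁ := by
  have := (Matrix.reindex (split₃ h) (split₃ h)).injective he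
  rw [Matrix.fromBlocks_inj, Matrix.fromBlocks_inj] at this
  exact ⟨this.1, this.2.2.2.1, this.2.2.2.2.2.2⟩

/-- The `2n × 2n` block matrix with blocks `X`, `Y`, `Z` on the second diagonal. -/
def anti₃ (h : i + j = n) (X : Matrix (Fin i) (Fin i) F) (Y : Matrix (Fin (2 * j)) (Fin (2 * j)) F)
    (Z : Matrix (Fin i) (Fin i) F) : Matrix (Fin (2 * n)) (Fin (2 * n)) F :=
  Matrix.reindex (split₃ h) (split₃ h)
    (Matrix.fromBlocks 0 (Matrix.fromCols 0 X) (Matrix.fromRows 0 Z) (Matrix.fromBlocks Y 0 0 0))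

theorem J_split : J F (2 * n) = anti₃ h (J F i) (J F (2 * j)) (J F i) := by
  rw [anti₃]
  ext r c
  obtain ⟨r, rfl⟩ := (split₃ h).surjective r
  obtain ⟨c, rfl⟩ := (split₃ h).surjective c
  have key : ∀ a b : Fin (2 * n), a = b.rev ↔ (a : ℕ) + b + 1 = 2 * n := by
    intro a b; rw [Fin.ext_iff, Fin.val_rev]; omega
  have key' : ∀ (k : ℕ) (a b : Fin k), a = b.rev ↔ (a : ℕ) + b + 1 = k := by
    intro k a b; rw [Fin.ext_iff, Fin.val_rev]; omega
  have v₁ : ∀ a : Fin i, ((split₃ h (Sum.inl a) : Fin (2 * n)) : ℕ) = a := by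
    intro a; simp [split₃]
  have v₂ : ∀ a : Fin (2 * j), ((split₃ h (Sum.inr (Sum.inl a)) : Fin (2 * n)) : ℕ) = i + a := by
    intro a; simp [split₃]
  have v₃ : ∀ a : Fin i,
      ((split₃ h (Sum.inr (Sum.inr a)) : Fin (2 * n)) : ℕ) = i + (2 * j + a) := by
    intro a; simp [split₃]
  simp only [Matrix.reindex_apply, Matrix.submatrix_apply, Equiv.symm_apply_apply]
  rcases r with (r | r | r) <;> rcases c with (c | c | c) <;>
    simp only [J, key, key', v₁, v₂, v₃, Matrix.of_apply, Matrix.fromBlocks_apply₁₁,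
      Matrix.fromBlocks_apply₁₂, Matrix.fromBlocks_apply₂₁, Matrix.fromBlocks_apply₂₂,
      Matrix.fromCols_apply_inl, Matrix.fromCols_apply_inr, Matrix.fromRows_apply_inl,
      Matrix.fromRows_apply_inr, Matrix.zero_apply]
  all_goals
    have hr := r.isLt
    have hc := c.isLt
    first
    | exact if_neg (by omega)
    | exact if_congr (by omega) rfl rfl

theorem up₃_mul_anti₃ (X : Matrix (Fin i) (Fin i) F) (Y : Matrix (Fin (2 * j)) (Fin (2 * j)) F)
    (Z : Matrix (Fin i) (Fin i) F) :
    up₃ h A 0 0 B 0 E * anti₃ h X Y Z = anti₃ h (A * X) (B * Y) (E * Z) := by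
  simp only [up₃, anti₃, Matrix.reindex_apply, Matrix.submatrix_mul_equiv,
    Matrix.fromBlocks_multiply]
  congr 2
  · simp
  · ext a (b | b) <;> simp [Matrix.mul_apply]
  · ext (a | a) b <;> simp [Matrix.mul_apply, Fintype.sum_sum_type]
  · simp

theorem anti₃_mul_up₃ (X : Matrix (Fin i) (Fin i) F) (Y : Matrix (Fin (2 * j)) (Fin (2 * j)) F)
    (Z : Matrix (Fin i) (Fin i) F) :
    anti₃ h X Y Z * up₃ h A 0 0 B 0 E = anti₃ h (X * E) (Y * B) (Z * A) := by
  simp only [up₃, anti₃, Matrix.reindex_apply, Matrix.submatrix_mul_equiv,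
    Matrix.fromBlocks_multiply]
  congr 2
  · simp
  · ext a (b | b) <;> simp [Matrix.mul_apply, Fintype.sum_sum_type]
  · ext (a | a) b <;> simp [Matrix.mul_apply]
  · simp

theorem anti₃_add (X X₁ : Matrix (Fin i) (Fin i) F) (Y Y₁ : Matrix (Fin (2 * j)) (Fin (2 * j)) F)
    (Z Z₁ : Matrix (Fin i) (Fin i) F) :
    anti₃ h X Y Z + anti₃ h X₁ Y₁ Z₁ = anti₃ h (X + X₁) (Y + Y₁) (Z + Z₁) := by
  ext r c
  obtain ⟨r, rfl⟩ := (split₃ h).surjective r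
  obtain ⟨c, rfl⟩ := (split₃ h).surjective c
  rcases r with (r | r | r) <;> rcases c with (c | c | c) <;> simp [anti₃]

theorem anti₃_zero : anti₃ h (0 : Matrix (Fin i) (Fin i) F) 0 0 = 0 := by
  simp [anti₃]

theorem up₃_conjTranspose [StarRing F] : (up₃ h A 0 0 B 0 E)ᴴ = up₃ h Aᴴ 0 0 Bᴴ 0 Eᴴ := by
  ext r c
  obtain ⟨r, rfl⟩ := (split₃ h).surjective r
  obtain ⟨c, rfl⟩ := (split₃ h).surjective c
  rcases r with (r | r | r) <;> rcases c with (c | c | c) <;> simp [up₃]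

theorem up₃_unip_inv {g : GL (Fin (2 * n)) F} {C : Matrix (Fin i) (Fin (2 * j)) F}
    {D : Matrix (Fin i) (Fin i) F} {C' : Matrix (Fin (2 * j)) (Fin i) F}
    (hg : (g : Matrix (Fin (2 * n)) (Fin (2 * n)) F) = up₃ h 1 C D 1 C' 1) :
    ((g⁻¹ : GL (Fin (2 * n)) F) : Matrix (Fin (2 * n)) (Fin (2 * n)) F) =
      up₃ h 1 (-C) (C * C' - D) 1 (-C') 1 := by
  apply Units.inv_eq_of_mul_eq_one_right
  rw [hg, up₃_mul, ← up₃_one h]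
  congr 1 <;> simp [sub_eq_add_neg, add_assoc, add_left_comm]

end up₃

section dual

theorem J_mul_J_mul {k : ℕ} (X : Matrix (Fin i) (Fin k) F) : J F i * (J F i * X) = X := by
  rw [← Matrix.mul_assoc, J_mul_J, Matrix.one_mul]

variable [StarRing F]

/-- `A' = J (A*)⁻¹ J`. -/
def dual (A : GL (Fin i) F) : Matrix (Fin i) (Fin i) F :=
  J F i * ((A : Matrix (Fin i) (Fin i) F)ᴴ)⁻¹ * J F i

/-- The Lie algebra version of `A ↦ A'`, namely `X ↦ -J X* J`. -/
def dualLie (X : Matrix (Fin i) (Fin i) F) : Matrix (Fin i) (Fin i) F := -(J F i * Xᴴ * J F i)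

theorem dual_eq (A : GL (Fin i) F) :
    dual A = J F i * ((A⁻¹ : GL (Fin i) F) : Matrix (Fin i) (Fin i) F)ᴴ * J F i := by
  rw [dual, ← Matrix.conjTranspose_nonsing_inv, Matrix.coe_units_inv]

theorem dual_mul (A B : GL (Fin i) F) : dual (A * B) = dual A * dual B := by
  simp only [dual_eq, mul_inv_rev, Units.val_mul, Matrix.conjTranspose_mul, mul_assoc, J_mul_J_mul]

theorem dual_one : dual (1 : GL (Fin i) F) = 1 := by
  simp [dual, J_mul_J]

theorem dual_mul_inv (A : GL (Fin i) F) : dual A * dual A⁻¹ = 1 := by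
  rw [← dual_mul, mul_inv_cancel, dual_one]

theorem dual_inv_mul (A : GL (Fin i) F) : dual A⁻¹ * dual A = 1 := by
  rw [← dual_mul, inv_mul_cancel, dual_one]

theorem dualLie_conj (A : GL (Fin i) F) (X : Matrix (Fin i) (Fin i) F) :
    dualLie ((A : Matrix (Fin i) (Fin i) F) * X *
      ((A⁻¹ : GL (Fin i) F) : Matrix (Fin i) (Fin i) F)) = dual A * dualLie X * dual A⁻¹ := by
  simp only [dual_eq, dualLie, inv_inv, Matrix.conjTranspose_mul, mul_assoc, J_mul_J_mul, mul_neg,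
    neg_mul]

variable (h : i + j = n)

theorem up₃_mem_uPair (g : GL (Fin (2 * n)) F) (A : GL (Fin i) F) (B : GL (Fin (2 * j)) F)
    (hB : B ∈ (uPair F (2 * j)).G)
    (hg : (g : Matrix (Fin (2 * n)) (Fin (2 * n)) F) = up₃ h A 0 0 B 0 (dual A)) :
    g ∈ (uPair F (2 * n)).G := by
  change (g : Matrix (Fin (2 * n)) (Fin (2 * n)) F)ᴴ * J F (2 * n) * _ = J F (2 * n)
  change (B : Matrix (Fin (2 * j)) (Fin (2 * j)) F)ᴴ * J F (2 * j) * _ = J F (2 * j) at hB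
  have h1 : (A : Matrix (Fin i) (Fin i) F)ᴴ *
      ((A⁻¹ : GL (Fin i) F) : Matrix (Fin i) (Fin i) F)ᴴ = 1 := by
    rw [← Matrix.conjTranspose_mul, ← Units.val_mul]; simp
  have h2 : ((A⁻¹ : GL (Fin i) F) : Matrix (Fin i) (Fin i) F) *
      (A : Matrix (Fin i) (Fin i) F) = 1 := by
    rw [← Units.val_mul]; simp
  rw [hg, up₃_conjTranspose, J_split h, up₃_mul_anti₃, anti₃_mul_up₃, hB]
  congr 1
  · rw [dual_eq, mul_assoc, mul_assoc, J_mul_J_mul, ← mul_assoc, h1, one_mul]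
  · rw [dual_eq]
    simp only [Matrix.conjTranspose_mul, J_conjTranspose, Matrix.conjTranspose_conjTranspose]
    simp only [mul_assoc, J_mul_J_mul, h2, mul_one]

theorem up₃_mem_uPair_Lie (A : Matrix (Fin i) (Fin i) F) (B : Matrix (Fin (2 * j)) (Fin (2 * j)) F)
    (hB : B ∈ (uPair F (2 * j)).Lie) :
    up₃ h A 0 0 B 0 (dualLie A) ∈ (uPair F (2 * n)).Lie := by
  change (up₃ h A 0 0 B 0 (dualLie A))ᴴ * J F (2 * n) + J F (2 * n) * _ = 0
  change Bᴴ * J F (2 * j) + J F (2 * j) * B = 0 at hB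
  rw [up₃_conjTranspose, J_split h, up₃_mul_anti₃, anti₃_mul_up₃, anti₃_add, hB, ← anti₃_zero h]
  congr 1
  · simp only [dualLie, mul_neg, mul_assoc, J_mul_J_mul, add_neg_cancel]
  · simp only [dualLie, Matrix.conjTranspose_neg, Matrix.conjTranspose_mul, J_conjTranspose,
      Matrix.conjTranspose_conjTranspose, neg_mul, mul_assoc, J_mul_J, mul_one, neg_add_cancel]

theorem up₃_inv {g : GL (Fin (2 * n)) F} {A : GL (Fin i) F} {B : GL (Fin (2 * j)) F}
    (hg : (g : Matrix (Fin (2 * n)) (Fin (2 * n)) F) = up₃ h A 0 0 B 0 (dual A)) :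
    ((g⁻¹ : GL (Fin (2 * n)) F) : Matrix (Fin (2 * n)) (Fin (2 * n)) F) =
      up₃ h (A⁻¹ : GL (Fin i) F) 0 0 (B⁻¹ : GL (Fin (2 * j)) F) 0 (dual A⁻¹) := by
  apply Units.inv_eq_of_mul_eq_one_right
  rw [hg, up₃_mul, ← up₃_one h, dual_mul_inv]
  simp

theorem exists_up₃ (A : GL (Fin i) F) (B : GL (Fin (2 * j)) F) :
    ∃ g : GL (Fin (2 * n)) F,
      (g : Matrix (Fin (2 * n)) (Fin (2 * n)) F) = up₃ h A 0 0 B 0 (dual A) :=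
  ⟨⟨up₃ h A 0 0 B 0 (dual A),
    up₃ h (A⁻¹ : GL (Fin i) F) 0 0 (B⁻¹ : GL (Fin (2 * j)) F) 0 (dual A⁻¹),
    by rw [up₃_mul, ← up₃_one h, dual_mul_inv]; simp,
    by rw [up₃_mul, ← up₃_one h, dual_inv_mul]; simp⟩, rfl⟩

end dual

/-- The subgroup of `U(2n)` of block diagonal matrices `diag(A, B, A')` with `A ∈ GL(i)`,
`B ∈ U(2j)` and `A' = J (A*)⁻¹ J`, and its Lie algebra, the matrices `diag(A, B, -J A* J)` with
`A ∈ 𝔤𝔩(i)`, `B ∈ 𝔲(2j)`. -/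
def uLevi (F : Type*) [Field F] [StarRing F] {i j n : ℕ} (h : i + j = n) : LiePair F (2 * n) where
  G :=
    { carrier := {g | ∃ (A : GL (Fin i) F), ∃ B ∈ (uPair F (2 * j)).G,
        (g : Matrix (Fin (2 * n)) (Fin (2 * n)) F) = up₃ h A 0 0 B 0 (dual A)}
      mul_mem' := by
        rintro g g' ⟨A, B, hB, hg⟩ ⟨A', B', hB', hg'⟩
        exact ⟨A * A', B * B', mul_mem hB hB', by
          rw [Units.val_mul, hg, hg', up₃_mul, dual_mul]; simp⟩
      one_mem' := ⟨1, 1, one_mem _, by simp [up₃_one, dual_one]⟩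
      inv_mem' := by
        rintro g ⟨A, B, hB, hg⟩
        exact ⟨A⁻¹, B⁻¹, inv_mem hB, up₃_inv h hg⟩ }
  Lie :=
    { carrier := {X | ∃ (A : Matrix (Fin i) (Fin i) F), ∃ B ∈ (uPair F (2 * j)).Lie,
        X = up₃ h A 0 0 B 0 (dualLie A)}
      add_mem' := by
        rintro _ _ ⟨A, B, hB, rfl⟩ ⟨A', B', hB', rfl⟩
        refine ⟨A + A', B + B', add_mem hB hB', ?_⟩
        rw [up₃_add]
        simp [dualLie, mul_add, add_mul, add_comm]
      zero_mem' := ⟨0, 0, zero_mem _, by simp [dualLie, up₃_zero]⟩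
      neg_mem' := by
        rintro _ ⟨A, B, hB, rfl⟩
        exact ⟨-A, -B, neg_mem hB, by rw [up₃_neg]; simp [dualLie]⟩ }
  conj_mem := by
    rintro g ⟨A, B, hB, hg⟩ _ ⟨X, Y, hY, rfl⟩
    refine ⟨(A : Matrix (Fin i) (Fin i) F) * X *
      ((A⁻¹ : GL (Fin i) F) : Matrix (Fin i) (Fin i) F), _, (uPair F (2 * j)).conj_mem B hB Y hY, ?_⟩
    rw [up₃_inv h hg, hg, up₃_mul, up₃_mul, dualLie_conj]
    simp

theorem uLevi_G_le (F : Type*) [Field F] [StarRing F] {i j n : ℕ} (h : i + j = n) :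
    (uLevi F h).G ≤ (uPair F (2 * n)).G := by
  rintro g ⟨A, B, hB, hg⟩
  exact up₃_mem_uPair h g A B hB hg

theorem uLevi_Lie_le (F : Type*) [Field F] [StarRing F] {i j n : ℕ} (h : i + j = n) :
    (uLevi F h).Lie ≤ (uPair F (2 * n)).Lie := by
  rintro _ ⟨A, B, hB, rfl⟩
  exact up₃_mem_uPair_Lie h A B hB

/-- The Levi decomposition of the block upper triangular subgroup of `U(2n)` with blocks of
sizes `i`, `2j`, `i`. The unipotent radical consists of the unitary matrices with block rows
`(1, C, D)`, `(0, 1, C')`, `(0, 0, 1)` (unitarity means here that `C' = -J C* J` and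
`J D + D* J = -J C J C* J`); its Lie algebra consists of the matrices in `𝔲(2n)` with
block rows `(0, C, D)`, `(0, 0, C')`, `(0, 0, 0)`. -/
def uParabolic (F : Type*) [Field F] [StarRing F] {i j n : ℕ} (h : i + j = n) :
    Parabolic (uPair F (2 * n)) where
  L := uLevi F h
  U :=
    { carrier := {g | g ∈ (uPair F (2 * n)).G ∧ ∃ (C : Matrix (Fin i) (Fin (2 * j)) F)
        (D : Matrix (Fin i) (Fin i) F) (C' : Matrix (Fin (2 * j)) (Fin i) F),
        (g : Matrix (Fin (2 * n)) (Fin (2 * n)) F) = up₃ h 1 C D 1 C' 1}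
      mul_mem' := by
        rintro g g' ⟨h₁, C, D, C', hg⟩ ⟨h₂, C₁, D₁, C₁', hg'⟩
        exact ⟨mul_mem h₁ h₂, C₁ + C, D₁ + C * C₁' + D, C₁' + C', by
          rw [Units.val_mul, hg, hg', up₃_mul]; simp⟩
      one_mem' := ⟨one_mem _, 0, 0, 0, by simp [up₃_one]⟩
      inv_mem' := by
        rintro g ⟨h₁, C, D, C', hg⟩
        exact ⟨inv_mem h₁, _, _, _, up₃_unip_inv h hg⟩ }
  nil :=
    { carrier := {X | X ∈ (uPair F (2 * n)).Lie ∧ ∃ (C : Matrix (Fin i) (Fin (2 * j)) F)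
        (D : Matrix (Fin i) (Fin i) F) (C' : Matrix (Fin (2 * j)) (Fin i) F),
        X = up₃ h 0 C D 0 C' 0}
      add_mem' := by
        rintro _ _ ⟨h₁, C, D, C', rfl⟩ ⟨h₂, C₁, D₁, C₁', rfl⟩
        exact ⟨add_mem h₁ h₂, C + C₁, D + D₁, C' + C₁', by rw [up₃_add]; simp⟩
      zero_mem' := ⟨zero_mem _, 0, 0, 0, (up₃_zero h).symm⟩
      neg_mem' := by
        rintro _ ⟨h₁, C, D, C', rfl⟩
        exact ⟨neg_mem h₁, -C, -D, -C', by rw [up₃_neg]; simp⟩ }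
  L_le := uLevi_G_le F h
  U_le := fun _ hg => hg.1
  LieL_le := uLevi_Lie_le F h
  nil_le := fun _ hX => hX.1
  disj := by
    rw [AddSubgroup.disjoint_def]
    rintro _ ⟨A, B, hB, rfl⟩ ⟨-, C, D, C', hC⟩
    obtain ⟨hA, hB', hE⟩ := up₃_inj h hC
    rw [hA] at hE
    rw [hA, hB', hE]
    exact up₃_zero h
  L_conj_U := by
    rintro g hgL u ⟨hu₁, C, D, C', hu⟩
    have hgG := uLevi_G_le F h hgL
    obtain ⟨A, B, hB, hg⟩ := hgL
    refine ⟨mul_mem (mul_mem hgG hu₁) (inv_mem hgG), ?_⟩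
    rw [Units.val_mul, Units.val_mul, up₃_inv h hg, hg, hu, up₃_mul, up₃_mul]
    simp only [mul_one, dual_mul_inv, Units.mul_inv]
    exact ⟨_, _, _, rfl⟩
  L_conj_nil := by
    rintro g hgL _ ⟨hZ, C, D, C', rfl⟩
    have hgG := uLevi_G_le F h hgL
    refine ⟨(uPair F (2 * n)).conj_mem g hgG _ hZ, ?_⟩
    obtain ⟨A, B, hB, hg⟩ := hgL
    rw [up₃_inv h hg, hg, up₃_mul, up₃_mul]
    simp only [mul_zero, zero_mul]
    exact ⟨_, _, _, rfl⟩
  U_conj_nil := by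
    rintro u ⟨hu₁, C, D, C', hu⟩ _ ⟨hZ, C₁, D₁, C₁', rfl⟩
    refine ⟨(uPair F (2 * n)).conj_mem u hu₁ _ hZ, ?_⟩
    rw [up₃_unip_inv h hu, hu, up₃_mul, up₃_mul]
    simp only [mul_zero, zero_mul]
    exact ⟨_, _, _, rfl⟩
  U_conj_L := by
    rintro u ⟨hu₁, C, D, C', hu⟩ Y hY
    refine ⟨sub_mem ((uPair F (2 * n)).conj_mem u hu₁ _ (uLevi_Lie_le F h hY))
      (uLevi_Lie_le F h hY), ?_⟩
    obtain ⟨A, B, hB, rfl⟩ := hY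
    rw [up₃_unip_inv h hu, hu, up₃_mul, up₃_mul, sub_eq_add_neg, up₃_neg, up₃_add]
    simp only [mul_one, one_mul, add_neg_cancel]
    exact ⟨_, _, _, rfl⟩

/-- The identification of `𝔤𝔩(i) × 𝔲(2j)` with the Levi subalgebra of `𝔲(2n)`. -/
def uBlock (F : Type*) [Field F] [StarRing F] {i j n : ℕ} (h : i + j = n) :
    (glPair F i).Lie × (uPair F (2 * j)).Lie ≃ (uLevi F h).Lie :=
  Equiv.ofBijective (fun X => ⟨up₃ h X.1 0 0 X.2 0 (dualLie X.1), X.1, X.2, X.2.2, rfl⟩) (by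
    constructor
    · rintro ⟨X, Y⟩ ⟨X', Y'⟩ he
      obtain ⟨h1, h2, -⟩ := up₃_inj h (congrArg Subtype.val he)
      exact Prod.ext (Subtype.ext h1) (Subtype.ext h2)
    · rintro ⟨_, A, B, hB, rfl⟩
      exact ⟨(⟨A, trivial⟩, ⟨B, hB⟩), rfl⟩)

theorem uBlock_apply (F : Type*) [Field F] [StarRing F] {i j n : ℕ} (h : i + j = n)
    (X : (glPair F i).Lie) (Y : (uPair F (2 * j)).Lie) :
    (uBlock F h (X, Y) : Matrix (Fin (2 * n)) (Fin (2 * n)) F) =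
      up₃ h X 0 0 Y 0 (dualLie (X : Matrix (Fin i) (Fin i) F)) := rfl

/-- The identification of `𝒞(𝔤𝔩(i)) ⊗ 𝒞(𝔲(2j))` with the invariant functions on the Levi
subalgebra of `𝔲(2n)`. -/
def uTensor (F : Type*) [Field F] [Finite F] [StarRing F] {i j n : ℕ} (h : i + j = n) :
    (glPair F i).C ⊗[ℝ] (uPair F (2 * j)).C ≃ₗ[ℝ] (uLevi F h).C :=
  boxEquiv (glPair F i) (uPair F (2 * j)) (uLevi F h) (uBlock F h)
    (by
      rintro ⟨g, A, B, hB, hg⟩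
      refine ⟨⟨A, trivial⟩, ⟨B, hB⟩, fun X Y => Subtype.ext ?_⟩
      simp only [LiePair.Ad, uBlock_apply, dualLie_conj]
      rw [up₃_inv h hg, hg, up₃_mul, up₃_mul]
      simp)
    (by
      rintro ⟨A, hA⟩ ⟨B, hB⟩
      obtain ⟨g, hg⟩ := exists_up₃ h A B
      refine ⟨⟨g, A, B, hB, hg⟩, fun X Y => Subtype.ext ?_⟩
      simp only [LiePair.Ad, uBlock_apply, dualLie_conj]
      rw [up₃_inv h hg, hg, up₃_mul, up₃_mul]
      simp)

/-! ### The graded spaces `A` and `B` and their structure maps -/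

section Graded

variable (F : Type*) [Field F]

/-- `A = ⨁ₙ 𝒞(𝔤𝔩(n, F))`. -/
abbrev A : Type _ := ⨁ n : ℕ, (glPair F n).C

/-- `B = ⨁ₙ 𝒞(𝔲(2n, F))`. -/
abbrev B [StarRing F] : Type _ := ⨁ n : ℕ, (uPair F (2 * n)).C

/-- The inclusion of the `n`-th graded part of `A`. -/
def incA (n : ℕ) : (glPair F n).C →ₗ[ℝ] A F := DirectSum.lof ℝ ℕ (fun n => (glPair F n).C) n

/-- The inclusion of the `n`-th graded part of `B`. -/
def incB [StarRing F] (n : ℕ) : (uPair F (2 * n)).C →ₗ[ℝ] B F :=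
  DirectSum.lof ℝ ℕ (fun n => (uPair F (2 * n)).C) n

/-- The inclusion `e : ℝ → A` of the degree zero part, `r` being identified with the constant
function `r` on `𝔤𝔩(0, F)`. -/
def unitA : ℝ →ₗ[ℝ] A F :=
  incA F 0 ∘ₗ
    { toFun := fun r => ⟨fun _ => r, fun _ _ => rfl⟩
      map_add' := fun _ _ => rfl
      map_smul' := fun _ _ => rfl }

/-- The projection `e* : A → ℝ` onto the degree zero part. -/
def counitA : A F →ₗ[ℝ] ℝ :=
  (LinearMap.proj (0 : (glPair F 0).Lie) ∘ₗ (glPair F 0).C.subtype) ∘ₗ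
    DirectSum.component ℝ ℕ (fun n => (glPair F n).C) 0

variable [Finite F]

/-- The multiplication `∇ : A ⊗ A → A`, given on `𝒞(𝔤𝔩(i)) ⊗ 𝒞(𝔤𝔩(j))` by parabolic induction
to `𝔤𝔩(i + j)`. -/
def nabla : A F ⊗[ℝ] A F →ₗ[ℝ] A F :=
  DirectSum.toModule ℝ (ℕ × ℕ) (A F)
      (fun p => incA F (p.1 + p.2) ∘ₗ (glParabolic F (rfl : p.1 + p.2 = p.1 + p.2)).ind ∘ₗ
        (glTensor F (rfl : p.1 + p.2 = p.1 + p.2)).toLinearMap) ∘ₗ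
    (TensorProduct.directSum ℝ ℝ (fun n => (glPair F n).C) (fun n => (glPair F n).C)).toLinearMap

/-- The comultiplication `Δ : A → A ⊗ A`, given on `𝒞(𝔤𝔩(n))` by the sum over `i + j = n` of the
parabolic restrictions to `𝒞(𝔤𝔩(i)) ⊗ 𝒞(𝔤𝔩(j))`. -/
def delta : A F →ₗ[ℝ] A F ⊗[ℝ] A F :=
  DirectSum.toModule ℝ ℕ (A F ⊗[ℝ] A F) fun n =>
    ∑ p : Finset.HasAntidiagonal.antidiagonal n,
      TensorProduct.map (incA F p.1.1) (incA F p.1.2) ∘ₗ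
        (glTensor F (Finset.HasAntidiagonal.mem_antidiagonal.mp p.2)).symm.toLinearMap ∘ₗ
        (glParabolic F (Finset.HasAntidiagonal.mem_antidiagonal.mp p.2)).res

variable [StarRing F]

/-- The map `∇̃ : A ⊗ B → B`, given on `𝒞(𝔤𝔩(i)) ⊗ 𝒞(𝔲(2j))` by parabolic induction to
`𝔲(2(i + j))`. -/
def nablaB : A F ⊗[ℝ] B F →ₗ[ℝ] B F :=
  DirectSum.toModule ℝ (ℕ × ℕ) (B F)
      (fun p => incB F (p.1 + p.2) ∘ₗ (uParabolic F (rfl : p.1 + p.2 = p.1 + p.2)).ind ∘ₗ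
        (uTensor F (rfl : p.1 + p.2 = p.1 + p.2)).toLinearMap) ∘ₗ
    (TensorProduct.directSum ℝ ℝ (fun n => (glPair F n).C)
      (fun n => (uPair F (2 * n)).C)).toLinearMap

/-- The map `Δ̃ : B → A ⊗ B`, given on `𝒞(𝔲(2n))` by the sum over `i + j = n` of the parabolic
restrictions to `𝒞(𝔤𝔩(i)) ⊗ 𝒞(𝔲(2j))`. -/
def deltaB : B F →ₗ[ℝ] A F ⊗[ℝ] B F :=
  DirectSum.toModule ℝ ℕ (A F ⊗[ℝ] B F) fun n =>
    ∑ p : Finset.HasAntidiagonal.antidiagonal n,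
      TensorProduct.map (incA F p.1.1) (incB F p.1.2) ∘ₗ
        (uTensor F (Finset.HasAntidiagonal.mem_antidiagonal.mp p.2)).symm.toLinearMap ∘ₗ
        (uParabolic F (Finset.HasAntidiagonal.mem_antidiagonal.mp p.2)).res

/-- The `n`-th graded part of `B`. -/
def gradeB (F : Type*) [Field F] [StarRing F] (n : ℕ) : Submodule ℝ (B F) :=
  LinearMap.range (incB F n)

/-- The `n`-th graded part of `A ⊗ B`: the sum of the `Aᵢ ⊗ Bⱼ` with `i + j = n`. -/
def gradeAB (F : Type*) [Field F] [StarRing F] (n : ℕ) : Submodule ℝ (A F ⊗[ℝ] B F) :=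
  ⨆ p ∈ Finset.HasAntidiagonal.antidiagonal n, LinearMap.range (TensorProduct.map (incA F p.1) (incB F p.2))

end Graded

/-- The involution `x ↦ x ^ q` of a field with `q²` elements. -/
abbrev frobeniusStarRing (q : ℕ) (F : Type*) [Field F] [Fintype F] (hF : Fintype.card F = q ^ 2) :
    StarRing F where
  star x := x ^ q
  star_involutive x := by
    change (x ^ q) ^ q = x
    rw [← pow_mul, ← pow_two, ← hF, FiniteField.pow_card]
  star_mul x y := by
    change (x * y) ^ q = y ^ q * x ^ q
    rw [mul_pow, mul_comm]
  star_add x y := by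
    change (x + y) ^ q = x ^ q + y ^ q
    obtain ⟨p, hp⟩ := CharP.exists F
    obtain ⟨k, hpr, hk⟩ := FiniteField.card F p
    have := Fact.mk hpr
    have hq : q ∣ p ^ (k : ℕ) := ⟨q, by rw [← hk, hF, pow_two]⟩
    obtain ⟨l, -, rfl⟩ := (Nat.dvd_prime_pow hpr).mp hq
    exact add_pow_char_pow x y p l

end

end LieInv

/-! Associativity and coassociativity are both transitivity of parabolic induction and restriction.
Fix sizes `a`, `b`, `c` and put `m = a + b`, `k = b + c`, `n = a + b + c`. In `𝔲(2n)` there is the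
fine flag with block sizes `a, b, 2c, b, a`. It refines the flag `m, 2c, m` by a triangular block in
`GL(m)`, and the flag `a, 2k, a` by a triangular block in `U(2k)`. `IsUp₃.refine_middle` and
`IsUp₃.refine_outer` show that both routes describe the same matrices with the same diagonal blocks.
The last blocks carry no further information: the unitary conditions are `jadj g * g = 1` and `jadj
X + X = 0`, where `jadj X = J X* J` is a reflection in the second diagonal, and they determine the
lower right blocks from the upper left ones.

Coassociativity: a double restriction of `Ψ`, evaluated at `(A, B, C)`, is an average of averages
over sets of equal size, hence the plain average of `Ψ` over all matrices in `𝔲(2n)` that are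
triangular for the fine flag with diagonal starting `A, B, C`. Both routes average over the same set
(`Parabolic.average_res_eq`, `res_res`, `uRes_coassoc`), so no cardinality has to be computed.

Associativity: induction is `|P|⁻¹` times a sum over the whole group (`Parabolic.ind_apply`). An
inner induction is an average of translates by elements of the Levi subgroup, and the outer sum over
`G` absorbs such translations (`Parabolic.ind_of_average`). Both double inductions are therefore
multiples of the sum over `G` of one function, the extension by zero from the fine flag
(`extend_extend`). The multiples agree because `|P| = |L| |U|` and because the products of the
orders of the two unipotent radicals on either route both count the unipotent radical of the fine
flag (`card_U_mul_card_U`, `ind_ind`).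

For the unit and counit, an outer block of size `0` gives `P = G` and a zero nilradical. The rest is
linear algebra: elements of tensor products are compared through their values
(`evalLeft_injective`), and sums over `a + b + c = n` are regrouped. -/

namespace LieInv

noncomputable section

/-! ### Parabolic induction as an average over the group -/

section Abstract

variable {F : Type*} [Field F] {m : ℕ} {p : LiePair F m}

/-- Precomposing with an element of the Levi subgroup commutes with extension. -/
theorem Parabolic.extend_Ad_levi (Q : Parabolic p) (K : Q.L.Lie → ℝ) (l : Q.L.G) (W : p.Lie) :
    Q.extend K (p.Ad ⟨l, Q.L_le l.2⟩ W) = Q.extend (fun Y => K (Q.L.Ad l Y)) W := by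
  have key : ∀ (l : Q.L.G) (W : p.Lie) (Y : Q.L.Lie),
      (W : Matrix (Fin m) (Fin m) F) - (Y : Matrix (Fin m) (Fin m) F) ∈ Q.nil →
      ((p.Ad ⟨l, Q.L_le l.2⟩ W : p.Lie) : Matrix (Fin m) (Fin m) F) -
        (Q.L.Ad l Y : Matrix (Fin m) (Fin m) F) ∈ Q.nil := by
    intro l W Y h
    have := Q.conj_decomp l 1 l.2 (one_mem _) W Y h
    rw [mul_one] at this
    exact this
  by_cases h : ∃ Y : Q.L.Lie,
      (W : Matrix (Fin m) (Fin m) F) - (Y : Matrix (Fin m) (Fin m) F) ∈ Q.nil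
  · obtain ⟨Y, hY⟩ := h
    rw [Q.extend_eq _ _ Y hY, Q.extend_eq _ _ _ (key l W Y hY)]
  · rw [Q.extend_eq_zero _ _ h, Q.extend_eq_zero]
    rintro ⟨Y, hY⟩
    have := key l⁻¹ _ Y hY
    have h1 : p.Ad ⟨((l⁻¹ : Q.L.G) : GL (Fin m) F), Q.L_le (l⁻¹).2⟩
        (p.Ad ⟨l, Q.L_le l.2⟩ W) = W := by
      rw [← p.Ad_mul]
      convert p.Ad_one W
      apply Subtype.ext
      simp
    rw [h1] at this
    exact h ⟨_, this⟩

/-- Every element of `P` is a product `l u`, and uniquely so because `L` and `U` meet trivially. -/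
theorem Parabolic.card_P [Finite F] (Q : Parabolic p) (hd : Disjoint Q.L.G Q.U) :
    Nat.card (Q.P.subgroupOf p.G) = Nat.card Q.L.G * Nat.card Q.U := by
  rw [← Nat.card_prod]
  symm
  refine Nat.card_congr (Equiv.ofBijective (fun x : Q.L.G × Q.U =>
    (⟨⟨x.1 * x.2, mul_mem (Q.L_le x.1.2) (Q.U_le x.2.2)⟩,
      Subgroup.mem_subgroupOf.mpr ((Q.mem_P _).mpr ⟨x.1, x.1.2, x.2, x.2.2, rfl⟩)⟩ :
        Q.P.subgroupOf p.G)) ⟨?_, ?_⟩)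
  · intro x y hxy
    have h1 : (x.1 : GL (Fin m) F) * x.2 = y.1 * y.2 :=
      congrArg (fun z : Q.P.subgroupOf p.G => ((z : p.G) : GL (Fin m) F)) hxy
    have := Subgroup.mul_injective_of_disjoint hd h1
    exact this
  · rintro ⟨⟨g, hg⟩, hgP⟩
    obtain ⟨l, hl, u, hu, rfl⟩ := (Q.mem_P _).mp (Subgroup.mem_subgroupOf.mp hgP)
    exact ⟨⟨⟨l, hl⟩, ⟨u, hu⟩⟩, rfl⟩

variable [Finite F]

instance (p : LiePair F m) : Fintype p.G := Fintype.ofFinite _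

instance (p : LiePair F m) : Fintype p.Lie := Fintype.ofFinite _

/-- Parabolic induction as an average over the whole group. -/
theorem Parabolic.ind_apply (Q : Parabolic p) (Φ : Q.L.C) (X : p.Lie) :
    (Q.ind Φ : p.Lie → ℝ) X = (Nat.card (Q.P.subgroupOf p.G) : ℝ)⁻¹ *
      ∑ g : p.G, Q.extend Φ (p.Ad g⁻¹ X) := by
  classical
  change ∑ c : p.G ⧸ Q.P.subgroupOf p.G, Q.extend Φ (p.Ad (Quotient.out c)⁻¹ X) = _
  have hcard : (Nat.card (Q.P.subgroupOf p.G) : ℝ) ≠ 0 := by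
    exact_mod_cast Nat.card_pos.ne'
  -- Group the sum over `G` by left cosets of `P`: by `extend_out` the summand is constant on each
  -- coset, and each coset has `|P|` elements.
  rw [eq_inv_mul_iff_mul_eq₀ hcard, Finset.mul_sum,
    ← Finset.sum_fiberwise (Finset.univ) (fun g : p.G => (g : p.G ⧸ Q.P.subgroupOf p.G))]
  refine Finset.sum_congr rfl fun c _ => ?_
  rw [Finset.sum_congr rfl (g := fun _ => Q.extend Φ (p.Ad (Quotient.out c)⁻¹ X))]
  · rw [Finset.sum_const, nsmul_eq_mul]
    congr 2
    have e : (QuotientGroup.mk ⁻¹' {c} : Set p.G) ≃ Q.P.subgroupOf p.G := by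
      have := QuotientGroup.preimageMkEquivSubgroupProdSet (Q.P.subgroupOf p.G) {c}
      exact this.trans (Equiv.prodUnique _ _)
    rw [← Nat.card_congr e, Nat.card_eq_fintype_card, Fintype.card_subtype]
    congr 1
    ext g
    simp
  · intro g hg
    simp only [Finset.mem_filter, Finset.mem_univ, true_and] at hg
    rw [← hg, Q.extend_out]

theorem Parabolic.extend_const_mul_sum {ι : Type*} (Q : Parabolic p) (s : Finset ι) (c : ℝ)
    (K : ι → Q.L.Lie → ℝ) (W : p.Lie) :
    Q.extend (fun Y => c * ∑ k ∈ s, K k Y) W = c * ∑ k ∈ s, Q.extend (K k) W := by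
  simp only [Parabolic.extend]
  split_ifs <;> simp

/-- Induction of a function obtained by averaging `K` over conjugations by elements of the Levi
subgroup. -/
theorem Parabolic.ind_of_average {H : Type*} [Fintype H] (Q : Parabolic p) (Φ : Q.L.C) (c : ℝ)
    (l : H → Q.L.G) (K : Q.L.Lie → ℝ)
    (hΦ : ∀ Y, (Φ : Q.L.Lie → ℝ) Y = c * ∑ k, K (Q.L.Ad (l k) Y)) (X : p.Lie) :
    (Q.ind Φ : p.Lie → ℝ) X = (Nat.card (Q.P.subgroupOf p.G) : ℝ)⁻¹ * (c * Fintype.card H) *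
      ∑ g : p.G, Q.extend K (p.Ad g⁻¹ X) := by
  rw [Q.ind_apply, mul_assoc]
  congr 1
  have h1 : (Φ : Q.L.Lie → ℝ) = fun Y => c * ∑ k, K (Q.L.Ad (l k) Y) := funext hΦ
  simp only [h1]
  simp only [Q.extend_const_mul_sum Finset.univ c (fun k Y => K (Q.L.Ad (l k) Y)),
    ← Finset.mul_sum, mul_assoc]
  congr 1
  rw [Finset.sum_comm, ← nsmul_eq_mul, ← Finset.card_univ, ← Finset.sum_const]
  refine Finset.sum_congr rfl fun k _ => ?_
  -- Translation by `l k` is moved from the Levi subalgebra to the whole Lie algebra; the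
  -- substitution `g ↦ g * l k` then removes it, so every `k` contributes the same sum.
  simp only [← Q.extend_Ad_levi, ← p.Ad_mul]
  rw [← Equiv.sum_comp (Equiv.mulRight (⟨l k, Q.L_le (l k).2⟩ : p.G))]
  simp

end Abstract

/-! ### Elements of tensor products as functions -/

section Eval

variable {F : Type*} [Field F] {m m₁ m₂ : ℕ}

/-- Evaluation at `X` in the first factor. -/
def evalLeft (p : LiePair F m) (V : Type*) [AddCommGroup V] [Module ℝ V] (X : p.Lie) :
    p.C ⊗[ℝ] V →ₗ[ℝ] V :=
  (TensorProduct.lid ℝ V).toLinearMap ∘ₗ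
    TensorProduct.map (LinearMap.proj X ∘ₗ p.C.subtype) LinearMap.id

theorem evalLeft_tmul (p : LiePair F m) {V : Type*} [AddCommGroup V] [Module ℝ V] (X : p.Lie)
    (φ : p.C) (v : V) : evalLeft p V X (φ ⊗ₜ v) = (φ : p.Lie → ℝ) X • v := rfl

variable [Finite F]

/-- The indicator functions of orbits span `𝒞(𝔤)`, so `t` is the sum of the `χ_O ⊗ t(X_O)` with
`X_O` a point of the orbit `O`. Identities in iterated tensor products can thus be checked one
variable at a time. -/
theorem evalLeft_injective (p : LiePair F m) {V : Type*} [AddCommGroup V] [Module ℝ V]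
    {s t : p.C ⊗[ℝ] V} (h : ∀ X, evalLeft p V X s = evalLeft p V X t) : s = t := by
  have key : ∀ t : p.C ⊗[ℝ] V,
      ∑ O : Quotient p.orbitSetoid, p.chi O ⊗ₜ[ℝ] evalLeft p V O.out t = t := by
    intro t
    induction t with
    | zero => simp
    | add x y hx hy => simp [TensorProduct.tmul_add, Finset.sum_add_distrib, hx, hy]
    | tmul φ v =>
      conv_rhs => rw [← p.sum_chi φ, TensorProduct.sum_tmul]
      simp only [evalLeft_tmul, TensorProduct.smul_tmul]
  rw [← key s, ← key t]
  simp only [h]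

/-- Both sides are linear in `t`, so pure tensors suffice. Having all `t` matters for restriction,
which involves the inverse of the external product and yields no pure tensors. -/
theorem boxEquiv_apply (p₁ : LiePair F m₁) (p₂ : LiePair F m₂) (p : LiePair F m)
    (e : p₁.Lie × p₂.Lie ≃ p.Lie)
    (h : ∀ g : p.G, ∃ (g₁ : p₁.G) (g₂ : p₂.G), ∀ X Y,
      p.Ad g (e (X, Y)) = e (p₁.Ad g₁ X, p₂.Ad g₂ Y))
    (h' : ∀ (g₁ : p₁.G) (g₂ : p₂.G), ∃ g : p.G, ∀ X Y,
      p.Ad g (e (X, Y)) = e (p₁.Ad g₁ X, p₂.Ad g₂ Y))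
    (t : p₁.C ⊗[ℝ] p₂.C) (X : p₁.Lie) (Y : p₂.Lie) :
    (boxEquiv p₁ p₂ p e h h' t : p.Lie → ℝ) (e (X, Y)) =
      (evalLeft p₁ p₂.C X t : p₂.Lie → ℝ) Y := by
  induction t with
  | zero => rw [LinearEquiv.map_zero, LinearMap.map_zero]; rfl
  | add x y hx hy =>
    rw [LinearEquiv.map_add, LinearMap.map_add, Submodule.coe_add, Submodule.coe_add,
      Pi.add_apply, Pi.add_apply, hx, hy]
  | tmul φ ψ => rw [boxEquiv_tmul, evalLeft_tmul]; rfl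

end Eval

/-! ### Block triangular matrices and refinement of flags -/

section Blocks

variable {F : Type*} [Field F] {i j n a b c : ℕ}

theorem split₂_inl (h : i + j = n) (r : Fin i) : ((split₂ h (Sum.inl r) : Fin n) : ℕ) = r := by
  simp [split₂]

theorem split₂_inr (h : i + j = n) (r : Fin j) :
    ((split₂ h (Sum.inr r) : Fin n) : ℕ) = i + r := by
  simp [split₂]

theorem split₃_inl (h : i + j = n) (r : Fin i) :
    ((split₃ h (Sum.inl r) : Fin (2 * n)) : ℕ) = r := by
  simp [split₃]

theorem split₃_mid (h : i + j = n) (r : Fin (2 * j)) :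
    ((split₃ h (Sum.inr (Sum.inl r)) : Fin (2 * n)) : ℕ) = i + r := by
  simp [split₃]

theorem split₃_inr (h : i + j = n) (r : Fin i) :
    ((split₃ h (Sum.inr (Sum.inr r)) : Fin (2 * n)) : ℕ) = i + (2 * j + r) := by
  simp [split₃]

/-- `M` is block upper triangular with diagonal blocks `A`, `B`. -/
def IsUp₂ (h : i + j = n) (M : Matrix (Fin n) (Fin n) F) (A : Matrix (Fin i) (Fin i) F)
    (B : Matrix (Fin j) (Fin j) F) : Prop :=
  ∃ C, M = up₂ h A C B

/-- `W` is block upper triangular with diagonal blocks `A`, `B`, `E`. -/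
def IsUp₃ (h : i + j = n) (W : Matrix (Fin (2 * n)) (Fin (2 * n)) F)
    (A : Matrix (Fin i) (Fin i) F) (B : Matrix (Fin (2 * j)) (Fin (2 * j)) F)
    (E : Matrix (Fin i) (Fin i) F) : Prop :=
  ∃ C D C', W = up₃ h A C D B C' E

/-- Entrywise description with numerical indices: comparing different block decompositions of one
matrix becomes arithmetic with inequalities. -/
theorem isUp₂_iff (h : i + j = n) {M : Matrix (Fin n) (Fin n) F} {A : Matrix (Fin i) (Fin i) F}
    {B : Matrix (Fin j) (Fin j) F} :
    IsUp₂ h M A B ↔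
      (∀ r s : Fin i, M ⟨r, by omega⟩ ⟨s, by omega⟩ = A r s) ∧
      (∀ r s : Fin j, M ⟨i + r, by omega⟩ ⟨i + s, by omega⟩ = B r s) ∧
      (∀ r s : Fin n, (s : ℕ) < i → i ≤ (r : ℕ) → M r s = 0) := by
  have e1 : ∀ r : Fin i, (⟨r, by omega⟩ : Fin n) = split₂ h (Sum.inl r) :=
    fun r => Fin.ext (split₂_inl h r).symm
  have e2 : ∀ r : Fin j, (⟨i + r, by omega⟩ : Fin n) = split₂ h (Sum.inr r) :=
    fun r => Fin.ext (split₂_inr h r).symm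
  constructor
  · rintro ⟨C, rfl⟩
    refine ⟨fun r s => ?_, fun r s => ?_, fun r s => ?_⟩
    · rw [e1, e1]; simp [up₂]
    · rw [e2, e2]; simp [up₂]
    · obtain ⟨r, rfl⟩ := (split₂ h).surjective r
      obtain ⟨s, rfl⟩ := (split₂ h).surjective s
      rcases r with r | r <;> rcases s with s | s <;>
        simp only [split₂_inl, split₂_inr] <;> intro h1 h2
      · omega
      · omega
      · simp [up₂]
      · omega
  · rintro ⟨h1, h2, h3⟩
    refine ⟨Matrix.of fun r s => M (split₂ h (Sum.inl r)) (split₂ h (Sum.inr s)), ?_⟩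
    ext r s
    obtain ⟨r, rfl⟩ := (split₂ h).surjective r
    obtain ⟨s, rfl⟩ := (split₂ h).surjective s
    rcases r with r | r <;> rcases s with s | s
    · rw [← e1, ← e1, h1, e1, e1]; simp [up₂]
    · simp [up₂]
    · rw [h3 _ _ (by rw [split₂_inl]; omega) (by rw [split₂_inr]; omega)]; simp [up₂]
    · rw [← e2, ← e2, h2, e2, e2]; simp [up₂]

theorem isUp₃_iff (h : i + j = n) {W : Matrix (Fin (2 * n)) (Fin (2 * n)) F}
    {A : Matrix (Fin i) (Fin i) F} {B : Matrix (Fin (2 * j)) (Fin (2 * j)) F}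
    {E : Matrix (Fin i) (Fin i) F} :
    IsUp₃ h W A B E ↔
      (∀ r s : Fin i, W ⟨r, by omega⟩ ⟨s, by omega⟩ = A r s) ∧
      (∀ r s : Fin (2 * j), W ⟨i + r, by omega⟩ ⟨i + s, by omega⟩ = B r s) ∧
      (∀ r s : Fin i, W ⟨i + (2 * j + r), by omega⟩ ⟨i + (2 * j + s), by omega⟩ = E r s) ∧
      (∀ r s : Fin (2 * n), (s : ℕ) < i → i ≤ (r : ℕ) → W r s = 0) ∧
      (∀ r s : Fin (2 * n), (s : ℕ) < i + 2 * j → i + 2 * j ≤ (r : ℕ) → W r s = 0) := by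
  have e1 : ∀ r : Fin i, (⟨r, by omega⟩ : Fin (2 * n)) = split₃ h (Sum.inl r) :=
    fun r => Fin.ext (split₃_inl h r).symm
  have e2 : ∀ r : Fin (2 * j), (⟨i + r, by omega⟩ : Fin (2 * n)) = split₃ h (Sum.inr (Sum.inl r)) :=
    fun r => Fin.ext (split₃_mid h r).symm
  have e3 : ∀ r : Fin i,
      (⟨i + (2 * j + r), by omega⟩ : Fin (2 * n)) = split₃ h (Sum.inr (Sum.inr r)) :=
    fun r => Fin.ext (split₃_inr h r).symm
  constructor
  · rintro ⟨C, D, C', rfl⟩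
    refine ⟨fun r s => ?_, fun r s => ?_, fun r s => ?_, fun r s => ?_, fun r s => ?_⟩
    · rw [e1, e1]; simp [up₃]
    · rw [e2, e2]; simp [up₃]
    · rw [e3, e3]; simp [up₃]
    all_goals
      obtain ⟨r, rfl⟩ := (split₃ h).surjective r
      obtain ⟨s, rfl⟩ := (split₃ h).surjective s
      rcases r with r | r | r <;> rcases s with s | s | s <;>
        simp only [split₃_inl, split₃_mid, split₃_inr] <;> intro h1 h2 <;>
        first
        | omega
        | simp [up₃]
  · rintro ⟨h1, h2, h3, h4, h5⟩
    refine ⟨Matrix.of fun r s => W (split₃ h (Sum.inl r)) (split₃ h (Sum.inr (Sum.inl s))),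
      Matrix.of fun r s => W (split₃ h (Sum.inl r)) (split₃ h (Sum.inr (Sum.inr s))),
      Matrix.of fun r s => W (split₃ h (Sum.inr (Sum.inl r))) (split₃ h (Sum.inr (Sum.inr s))), ?_⟩
    ext r s
    obtain ⟨r, rfl⟩ := (split₃ h).surjective r
    obtain ⟨s, rfl⟩ := (split₃ h).surjective s
    rcases r with r | r | r <;> rcases s with s | s | s
    · rw [← e1, ← e1, h1, e1, e1]; simp [up₃]
    · simp [up₃]
    · simp [up₃]
    · rw [h4 _ _ (by rw [split₃_inl]; omega) (by rw [split₃_mid]; omega)]; simp [up₃]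
    · rw [← e2, ← e2, h2, e2, e2]; simp [up₃]
    · simp [up₃]
    · rw [h4 _ _ (by rw [split₃_inl]; omega) (by rw [split₃_inr]; omega)]; simp [up₃]
    · rw [h5 _ _ (by rw [split₃_mid]; omega) (by rw [split₃_inr]; omega)]; simp [up₃]
    · rw [← e3, ← e3, h3, e3, e3]; simp [up₃]

variable {m k : ℕ}

/-- Refining a flag: block sizes `a + b, 2c, a + b` with triangular outer blocks give block sizes
`a, 2(b + c), a` with triangular middle block. -/
theorem IsUp₃.refine_middle (hm : a + b = m) (hm' : b + a = m) (h : m + c = n) (hk : b + c = k)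
    (h' : a + k = n) {W : Matrix (Fin (2 * n)) (Fin (2 * n)) F} {M M' : Matrix (Fin m) (Fin m) F}
    {A A' : Matrix (Fin a) (Fin a) F} {B B' : Matrix (Fin b) (Fin b) F}
    {C : Matrix (Fin (2 * c)) (Fin (2 * c)) F}
    (hW : IsUp₃ h W M C M') (hM : IsUp₂ hm M A B) (hM' : IsUp₂ hm' M' B' A') :
    ∃ N, IsUp₃ h' W A N A' ∧ IsUp₃ hk N B C B' := by
  obtain ⟨w1, w2, w3, w4, w5⟩ := (isUp₃_iff h).mp hW
  obtain ⟨m1, m2, m3⟩ := (isUp₂_iff hm).mp hM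
  obtain ⟨n1, n2, n3⟩ := (isUp₂_iff hm').mp hM'
  -- The zeros below the first `a` columns come from `M` in rows before `m` and from the coarse flag
  -- in later rows.
  have z1 : ∀ r s : Fin (2 * n), (s : ℕ) < a → a ≤ (r : ℕ) → W r s = 0 := by
    intro r s hs hr
    by_cases hrm : (r : ℕ) < m
    · rw [← m3 ⟨r, hrm⟩ ⟨s, by omega⟩ hs hr, ← w1]
    · exact w4 _ _ (by omega) (by omega)
  -- Symmetrically, the zeros to the left of the last `a` columns come from the coarse flag or from
  -- `M'`. Here `m + 2 * c + b = a + 2 * k`.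
  have z2 : ∀ r s : Fin (2 * n), (s : ℕ) < m + 2 * c + b → m + 2 * c + b ≤ (r : ℕ) →
      W r s = 0 := by
    intro r s hs hr
    by_cases hsm : (s : ℕ) < m + 2 * c
    · exact w5 _ _ hsm (by omega)
    · rw [← n3 ⟨r - (m + 2 * c), by omega⟩ ⟨s - (m + 2 * c), by omega⟩
        (by simp only; omega) (by simp only; omega), ← w3]
      congr 1 <;> ext <;> simp only <;> omega
  refine ⟨Matrix.of fun r s => W ⟨a + r, by omega⟩ ⟨a + s, by omega⟩, ?_, ?_⟩
  · refine (isUp₃_iff h').mpr ⟨fun r s => ?_, fun r s => rfl, fun r s => ?_, z1, fun r s hs hr => ?_⟩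
    · rw [← m1, ← w1]
    · rw [← n2, ← w3]
      congr 1 <;> ext <;> simp only <;> omega
    · exact z2 _ _ (by omega) (by omega)
  · refine (isUp₃_iff hk).mpr ⟨fun r s => ?_, fun r s => ?_, fun r s => ?_, fun r s hs hr => ?_,
      fun r s hs hr => ?_⟩
    · rw [← m2, ← w1]; rfl
    · rw [← w2]
      simp only [Matrix.of_apply]
      congr 1 <;> ext <;> simp only <;> omega
    · rw [← n1, ← w3]
      simp only [Matrix.of_apply]
      congr 1 <;> ext <;> simp only <;> omega
    · exact w4 _ _ (by simp only; omega) (by simp only; omega)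
    · exact w5 _ _ (by simp only; omega) (by simp only; omega)

/-- Refining a flag: block sizes `a, 2(b + c), a` with triangular middle block give block sizes
`a + b, 2c, a + b` with triangular outer blocks. -/
theorem IsUp₃.refine_outer (hm : a + b = m) (hm' : b + a = m) (h : m + c = n) (hk : b + c = k)
    (h' : a + k = n) {W : Matrix (Fin (2 * n)) (Fin (2 * n)) F}
    {N : Matrix (Fin (2 * k)) (Fin (2 * k)) F}
    {A A' : Matrix (Fin a) (Fin a) F} {B B' : Matrix (Fin b) (Fin b) F}
    {C : Matrix (Fin (2 * c)) (Fin (2 * c)) F}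
    (hW : IsUp₃ h' W A N A') (hN : IsUp₃ hk N B C B') :
    ∃ M M', IsUp₃ h W M C M' ∧ IsUp₂ hm M A B ∧ IsUp₂ hm' M' B' A' := by
  obtain ⟨w1, w2, w3, w4, w5⟩ := (isUp₃_iff h').mp hW
  obtain ⟨n1, n2, n3, n4, n5⟩ := (isUp₃_iff hk).mp hN
  -- The middle block `N` read off with the indices of `W`, shifted by `a`; the zeros of `N` become
  -- zeros of `W` in this form.
  have w2' : ∀ r s : Fin (2 * n), ∀ (hr : a ≤ (r : ℕ)) (hr' : (r : ℕ) < a + 2 * k)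
      (hs : a ≤ (s : ℕ)) (hs' : (s : ℕ) < a + 2 * k),
      W r s = N ⟨r - a, by omega⟩ ⟨s - a, by omega⟩ := by
    intro r s hr hr' hs hs'
    rw [← w2]
    congr 1 <;> ext <;> simp only <;> omega
  refine ⟨Matrix.of fun r s => W ⟨r, by omega⟩ ⟨s, by omega⟩,
    Matrix.of fun r s => W ⟨m + (2 * c + r), by omega⟩ ⟨m + (2 * c + s), by omega⟩, ?_, ?_, ?_⟩
  · refine (isUp₃_iff h).mpr ⟨fun r s => rfl, fun r s => ?_, fun r s => rfl, fun r s hs hr => ?_,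
      fun r s hs hr => ?_⟩
    · rw [← n2, ← w2]
      congr 1 <;> ext <;> simp only <;> omega
    · by_cases hsa : (s : ℕ) < a
      · exact w4 _ _ hsa (by omega)
      · by_cases hrk : (r : ℕ) < a + 2 * k
        · rw [w2' r s (by omega) hrk (by omega) (by omega)]
          exact n4 _ _ (by simp only; omega) (by simp only; omega)
        · exact w5 _ _ (by omega) (by omega)
    · by_cases hsa : (s : ℕ) < a
      · exact w4 _ _ hsa (by omega)
      · by_cases hrk : (r : ℕ) < a + 2 * k
        · rw [w2' r s (by omega) hrk (by omega) (by omega)]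
          exact n5 _ _ (by simp only; omega) (by simp only; omega)
        · exact w5 _ _ (by omega) (by omega)
  · refine (isUp₂_iff hm).mpr ⟨fun r s => w1 r s, fun r s => ?_, fun r s hs hr => ?_⟩
    · rw [← n1, ← w2]
      rfl
    · exact w4 _ _ hs hr
  · refine (isUp₂_iff hm').mpr ⟨fun r s => ?_, fun r s => ?_, fun r s hs hr => ?_⟩
    · rw [← n3, ← w2]
      simp only [Matrix.of_apply]
      congr 1 <;> ext <;> simp only <;> omega
    · rw [← w3]
      simp only [Matrix.of_apply]
      congr 1 <;> ext <;> simp only <;> omega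
    · exact w5 _ _ (by simp only; omega) (by simp only; omega)

end Blocks

/-! ### The adjoint for the form `J` and unitary block matrices -/

section BlockAlgebra

variable {F : Type*} [Field F] {i j n : ℕ}

theorem IsUp₂.inj {h : i + j = n} {M : Matrix (Fin n) (Fin n) F}
    {A A₁ : Matrix (Fin i) (Fin i) F} {B B₁ : Matrix (Fin j) (Fin j) F}
    (hM : IsUp₂ h M A B) (hM₁ : IsUp₂ h M A₁ B₁) : A = A₁ ∧ B = B₁ := by
  obtain ⟨C, rfl⟩ := hM
  obtain ⟨C₁, h₁⟩ := hM₁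
  exact ⟨(up₂_inj h h₁).1, (up₂_inj h h₁).2.2⟩

theorem IsUp₃.mul {h : i + j = n} {W W₁ : Matrix (Fin (2 * n)) (Fin (2 * n)) F}
    {A A₁ : Matrix (Fin i) (Fin i) F} {B B₁ : Matrix (Fin (2 * j)) (Fin (2 * j)) F}
    {E E₁ : Matrix (Fin i) (Fin i) F} (hW : IsUp₃ h W A B E) (hW₁ : IsUp₃ h W₁ A₁ B₁ E₁) :
    IsUp₃ h (W * W₁) (A * A₁) (B * B₁) (E * E₁) := by
  obtain ⟨C, D, C', rfl⟩ := hW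
  obtain ⟨C₁, D₁, C'₁, rfl⟩ := hW₁
  exact ⟨_, _, _, up₃_mul h⟩

theorem IsUp₃.add {h : i + j = n} {W W₁ : Matrix (Fin (2 * n)) (Fin (2 * n)) F}
    {A A₁ : Matrix (Fin i) (Fin i) F} {B B₁ : Matrix (Fin (2 * j)) (Fin (2 * j)) F}
    {E E₁ : Matrix (Fin i) (Fin i) F} (hW : IsUp₃ h W A B E) (hW₁ : IsUp₃ h W₁ A₁ B₁ E₁) :
    IsUp₃ h (W + W₁) (A + A₁) (B + B₁) (E + E₁) := by
  obtain ⟨C, D, C', rfl⟩ := hW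
  obtain ⟨C₁, D₁, C'₁, rfl⟩ := hW₁
  exact ⟨_, _, _, up₃_add h⟩

theorem IsUp₃.neg {h : i + j = n} {W : Matrix (Fin (2 * n)) (Fin (2 * n)) F}
    {A : Matrix (Fin i) (Fin i) F} {B : Matrix (Fin (2 * j)) (Fin (2 * j)) F}
    {E : Matrix (Fin i) (Fin i) F} (hW : IsUp₃ h W A B E) : IsUp₃ h (-W) (-A) (-B) (-E) := by
  obtain ⟨C, D, C', rfl⟩ := hW
  exact ⟨_, _, _, up₃_neg h⟩

theorem IsUp₃.inj {h : i + j = n} {W : Matrix (Fin (2 * n)) (Fin (2 * n)) F}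
    {A A₁ : Matrix (Fin i) (Fin i) F} {B B₁ : Matrix (Fin (2 * j)) (Fin (2 * j)) F}
    {E E₁ : Matrix (Fin i) (Fin i) F} (hW : IsUp₃ h W A B E) (hW₁ : IsUp₃ h W A₁ B₁ E₁) :
    A = A₁ ∧ B = B₁ ∧ E = E₁ := by
  obtain ⟨C, D, C', rfl⟩ := hW
  obtain ⟨C₁, D₁, C'₁, h₁⟩ := hW₁
  exact up₃_inj h h₁

theorem isUp₃_zero (h : i + j = n) :
    IsUp₃ h (0 : Matrix (Fin (2 * n)) (Fin (2 * n)) F) 0 0 0 :=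
  ⟨0, 0, 0, (up₃_zero h).symm⟩

theorem isUp₃_one (h : i + j = n) :
    IsUp₃ h (1 : Matrix (Fin (2 * n)) (Fin (2 * n)) F) 1 1 1 :=
  ⟨0, 0, 0, (up₃_one h).symm⟩

theorem IsUp₂.neg {h : i + j = n} {M : Matrix (Fin n) (Fin n) F}
    {A : Matrix (Fin i) (Fin i) F} {B : Matrix (Fin j) (Fin j) F} (hM : IsUp₂ h M A B) :
    IsUp₂ h (-M) (-A) (-B) := by
  obtain ⟨C, rfl⟩ := hM
  exact ⟨_, up₂_neg h _ _ _⟩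

/-- The identification of `𝔤𝔩(i) × 𝔤𝔩(j)` with the Levi subalgebra of the parabolic. -/
def glParBlock (F : Type*) [Field F] {i j n : ℕ} (h : i + j = n) :
    (glPair F i).Lie × (glPair F j).Lie ≃ (glParabolic F h).L.Lie := glBlock F h

/-- The identification of `𝔤𝔩(i) × 𝔲(2j)` with the Levi subalgebra of the parabolic. -/
def uParBlock (F : Type*) [Field F] [StarRing F] {i j n : ℕ} (h : i + j = n) :
    (glPair F i).Lie × (uPair F (2 * j)).Lie ≃ (uParabolic F h).L.Lie := uBlock F h

/-- A decomposition of an element of `𝔤𝔩(n)` along the parabolic subalgebra. -/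
theorem sub_mem_glParabolic_nil (h : i + j = n) (M : Matrix (Fin n) (Fin n) F)
    (X : (glPair F i).Lie × (glPair F j).Lie) :
    M - (glParBlock F h X : Matrix (Fin n) (Fin n) F) ∈ (glParabolic F h).nil ↔
      IsUp₂ h M X.1 X.2 := by
  change (∃ C, M - up₂ h X.1 0 X.2 = up₂ h 0 C 0) ↔ ∃ C, M = up₂ h X.1 C X.2
  refine exists_congr fun C => ?_
  rw [sub_eq_iff_eq_add, up₂_add]
  simp

variable [StarRing F]

/-- The adjoint of `X` with respect to the form defined by `J`. -/
def jadj {m : ℕ} (X : Matrix (Fin m) (Fin m) F) : Matrix (Fin m) (Fin m) F := J F m * Xᴴ * J F m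

/-- Multiplication by `J` on the left and right reverses rows and columns, so `jadj` is reflection
in the second diagonal followed by `star`. It therefore preserves block upper triangular shape. -/
theorem jadj_apply {m : ℕ} (X : Matrix (Fin m) (Fin m) F) (r s : Fin m) :
    jadj X r s = star (X s.rev r.rev) := by
  have h1 : ∀ x : Fin m, s = x.rev ↔ x = s.rev := fun x =>
    ⟨fun h => by rw [h, Fin.rev_rev], fun h => by rw [h, Fin.rev_rev]⟩
  simp [jadj, Matrix.mul_apply, J, h1]

theorem jadj_mul {m : ℕ} (X Y : Matrix (Fin m) (Fin m) F) :
    jadj (X * Y) = jadj Y * jadj X := by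
  simp only [jadj, Matrix.conjTranspose_mul, mul_assoc, J_mul_J_mul]

theorem jadj_one (m : ℕ) : jadj (1 : Matrix (Fin m) (Fin m) F) = 1 := by
  simp [jadj, J_mul_J]

theorem dual_eq_jadj {m : ℕ} (A : GL (Fin m) F) :
    dual A = jadj ((A⁻¹ : GL (Fin m) F) : Matrix (Fin m) (Fin m) F) := dual_eq A

/-- Multiply by `J` and use `J² = 1`. In this form the condition involves only sums and products of
block triangular matrices, and can be compared block by block. -/
theorem mem_uPair_G_iff {m : ℕ} (g : GL (Fin m) F) :
    g ∈ (uPair F m).G ↔ jadj (g : Matrix (Fin m) (Fin m) F) * g = 1 := by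
  change (g : Matrix (Fin m) (Fin m) F)ᴴ * J F m * g = J F m ↔ _
  constructor
  · intro h
    rw [jadj, mul_assoc, mul_assoc, ← mul_assoc _ (J F m), h, J_mul_J]
  · intro h
    have := congrArg (fun x => J F m * x) h
    simpa only [jadj, mul_assoc, J_mul_J_mul, mul_one] using this

theorem mem_uPair_Lie_iff {m : ℕ} (X : Matrix (Fin m) (Fin m) F) :
    X ∈ (uPair F m).Lie ↔ jadj X + X = 0 := by
  change Xᴴ * J F m + J F m * X = 0 ↔ _
  have h1 : jadj X + X = J F m * (Xᴴ * J F m + J F m * X) := by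
    rw [mul_add, J_mul_J_mul, jadj, mul_assoc]
  rw [h1]
  constructor
  · intro h
    rw [h, mul_zero]
  · intro h
    rw [← J_mul_J_mul (Xᴴ * J F m + J F m * X), h, Matrix.mul_zero]

/-- Reflection in the second diagonal exchanges the two diagonal blocks, hence the block sizes `j`,
`i` in this order. -/
theorem IsUp₂.jadj {h : i + j = n} (h' : j + i = n) {M : Matrix (Fin n) (Fin n) F}
    {A : Matrix (Fin i) (Fin i) F} {B : Matrix (Fin j) (Fin j) F} (hM : IsUp₂ h M A B) :
    IsUp₂ h' (jadj M) (jadj B) (jadj A) := by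
  obtain ⟨m1, m2, m3⟩ := (isUp₂_iff h).mp hM
  refine (isUp₂_iff h').mpr ⟨fun r s => ?_, fun r s => ?_, fun r s hs hr => ?_⟩
  · rw [jadj_apply, jadj_apply, ← m2]
    congr 2 <;> ext <;> simp only [Fin.val_rev] <;> omega
  · rw [jadj_apply, jadj_apply, ← m1]
    congr 2 <;> ext <;> simp only [Fin.val_rev] <;> omega
  · rw [jadj_apply, m3 _ _ (by rw [Fin.val_rev]; omega) (by rw [Fin.val_rev]; omega), star_zero]

theorem IsUp₂.dualLie {h : i + j = n} (h' : j + i = n) {M : Matrix (Fin n) (Fin n) F}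
    {A : Matrix (Fin i) (Fin i) F} {B : Matrix (Fin j) (Fin j) F} (hM : IsUp₂ h M A B) :
    IsUp₂ h' (dualLie M) (dualLie B) (dualLie A) :=
  (hM.jadj h').neg

theorem IsUp₃.jadj {h : i + j = n} {W : Matrix (Fin (2 * n)) (Fin (2 * n)) F}
    {A : Matrix (Fin i) (Fin i) F} {B : Matrix (Fin (2 * j)) (Fin (2 * j)) F}
    {E : Matrix (Fin i) (Fin i) F} (hW : IsUp₃ h W A B E) :
    IsUp₃ h (jadj W) (jadj E) (jadj B) (jadj A) := by
  obtain ⟨w1, w2, w3, w4, w5⟩ := (isUp₃_iff h).mp hW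
  refine (isUp₃_iff h).mpr ⟨fun r s => ?_, fun r s => ?_, fun r s => ?_, fun r s hs hr => ?_,
    fun r s hs hr => ?_⟩
  · rw [jadj_apply, jadj_apply, ← w3]
    congr 2 <;> ext <;> simp only [Fin.val_rev] <;> omega
  · rw [jadj_apply, jadj_apply, ← w2]
    congr 2 <;> ext <;> simp only [Fin.val_rev] <;> omega
  · rw [jadj_apply, jadj_apply, ← w1]
    congr 2 <;> ext <;> simp only [Fin.val_rev] <;> omega
  · rw [jadj_apply, w5 _ _ (by rw [Fin.val_rev]; omega) (by rw [Fin.val_rev]; omega), star_zero]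
  · rw [jadj_apply, w4 _ _ (by rw [Fin.val_rev]; omega) (by rw [Fin.val_rev]; omega), star_zero]

/-- Compare the diagonal blocks of `jadj W + W = 0`: the middle one says that `B` lies in `𝔲(2j)`,
the last one that `E = -jadj A`. -/
theorem IsUp₃.of_mem_Lie {h : i + j = n} {W : Matrix (Fin (2 * n)) (Fin (2 * n)) F}
    {A : Matrix (Fin i) (Fin i) F} {B : Matrix (Fin (2 * j)) (Fin (2 * j)) F}
    {E : Matrix (Fin i) (Fin i) F} (hW : IsUp₃ h W A B E) (hu : W ∈ (uPair F (2 * n)).Lie) :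
    B ∈ (uPair F (2 * j)).Lie ∧ E = dualLie A := by
  rw [mem_uPair_Lie_iff] at hu ⊢
  have h1 := hW.jadj.add hW
  rw [hu] at h1
  obtain ⟨-, h2, h3⟩ := h1.inj (isUp₃_zero h)
  exact ⟨h2, eq_neg_of_add_eq_zero_right h3⟩

/-- Group version of the same comparison, for `jadj g * g = 1`. -/
theorem IsUp₃.of_mem_G {h : i + j = n} {g : GL (Fin (2 * n)) F}
    {A : Matrix (Fin i) (Fin i) F} {B : Matrix (Fin (2 * j)) (Fin (2 * j)) F}
    {E : Matrix (Fin i) (Fin i) F} (hg : IsUp₃ h (g : Matrix (Fin (2 * n)) (Fin (2 * n)) F) A B E)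
    (hu : g ∈ (uPair F (2 * n)).G) :
    LieInv.jadj B * B = 1 ∧ LieInv.jadj A * E = 1 := by
  rw [mem_uPair_G_iff] at hu
  have h1 := hg.jadj.mul hg
  rw [hu] at h1
  obtain ⟨-, h2, h3⟩ := h1.inj (isUp₃_one h)
  exact ⟨h2, h3⟩

theorem isUp₃_uParBlock (h : i + j = n) (X : (glPair F i).Lie × (uPair F (2 * j)).Lie) :
    IsUp₃ h (uParBlock F h X : Matrix (Fin (2 * n)) (Fin (2 * n)) F) X.1 X.2
      (dualLie (X.1 : Matrix (Fin i) (Fin i) F)) :=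
  ⟨0, 0, 0, rfl⟩

/-- A decomposition of an element of `𝔲(2n)` along the parabolic subalgebra. -/
theorem sub_mem_uParabolic_nil (h : i + j = n) (W : (uPair F (2 * n)).Lie)
    (X : (glPair F i).Lie × (uPair F (2 * j)).Lie) :
    (W : Matrix (Fin (2 * n)) (Fin (2 * n)) F) - (uParBlock F h X : Matrix _ _ F) ∈
      (uParabolic F h).nil ↔
      IsUp₃ h (W : Matrix (Fin (2 * n)) (Fin (2 * n)) F) X.1 X.2
        (dualLie (X.1 : Matrix (Fin i) (Fin i) F)) := by
  constructor
  · rintro ⟨-, h1⟩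
    have h2 : IsUp₃ h ((W : Matrix (Fin (2 * n)) (Fin (2 * n)) F) - (uParBlock F h X : Matrix _ _ F))
      0 0 0 := h1
    have h3 := h2.add (isUp₃_uParBlock h X)
    simpa using h3
  · intro h1
    refine ⟨sub_mem W.2 ((uParabolic F h).LieL_le (uParBlock F h X).2), ?_⟩
    have h3 := h1.add (isUp₃_uParBlock h X).neg
    simp only [add_neg_cancel, ← sub_eq_add_neg] at h3
    exact h3

end BlockAlgebra

/-! ### Transitivity of parabolic restriction -/

section Restriction

variable {F : Type*} [Field F] [Finite F] {m : ℕ} {p : LiePair F m}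

/-- An average of values of a parabolic restriction is the average of the original function over
all elements projecting to the given points of the Levi subalgebra. -/
theorem Parabolic.average_res {α : Type*} [Fintype α] (Q : Parabolic p) (Ψ : p.C)
    (y : α → Q.L.Lie) (hy : Function.Injective y) (S : Finset p.Lie)
    (hS : ∀ W : p.Lie, W ∈ S ↔ ∃ a,
      (W : Matrix (Fin m) (Fin m) F) - (y a : Matrix (Fin m) (Fin m) F) ∈ Q.nil) :
    (Fintype.card α : ℝ)⁻¹ * ∑ a, (Q.res Ψ : Q.L.Lie → ℝ) (y a) =
      (S.card : ℝ)⁻¹ * ∑ W ∈ S, (Ψ : p.Lie → ℝ) W := by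
  let f : α × Q.nil → p.Lie := fun x =>
    ⟨(y x.1 : Matrix (Fin m) (Fin m) F) + (x.2 : Matrix (Fin m) (Fin m) F),
      add_mem (Q.LieL_le (y x.1).2) (Q.nil_le x.2.2)⟩
  -- The sums `y a + Z` are pairwise distinct because the Levi subalgebra meets the nilradical in
  -- `0`; thus they list each element of `S` exactly once.
  have hf : Function.Injective f := by
    rintro ⟨a, Z⟩ ⟨a', Z'⟩ he
    have h1 : (y a : Matrix (Fin m) (Fin m) F) + (Z : Matrix (Fin m) (Fin m) F) =
      (y a' : Matrix (Fin m) (Fin m) F) + (Z' : Matrix (Fin m) (Fin m) F) :=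
      congrArg Subtype.val he
    have h2 : (y a : Matrix (Fin m) (Fin m) F) - (y a' : Matrix (Fin m) (Fin m) F) =
        (Z' : Matrix (Fin m) (Fin m) F) - (Z : Matrix (Fin m) (Fin m) F) := by
      rw [sub_eq_sub_iff_add_eq_add, h1, add_comm]
    have h3 := (AddSubgroup.disjoint_def.mp Q.disj) (sub_mem (y a).2 (y a').2)
      (h2 ▸ sub_mem Z'.2 Z.2)
    have h4 : a = a' := hy (Subtype.ext (sub_eq_zero.mp h3))
    rw [h3] at h2
    exact Prod.ext h4 (Subtype.ext (sub_eq_zero.mp h2.symm).symm)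
  have hSf : S = Finset.univ.map ⟨f, hf⟩ := by
    ext W
    simp only [hS, Finset.mem_map, Finset.mem_univ, true_and, Function.Embedding.coeFn_mk]
    constructor
    · rintro ⟨a, ha⟩
      exact ⟨(a, ⟨_, ha⟩), Subtype.ext (add_sub_cancel _ _)⟩
    · rintro ⟨⟨a, Z⟩, rfl⟩
      refine ⟨a, ?_⟩
      simp only [f, add_sub_cancel_left]
      exact Z.2
  rw [hSf, Finset.card_map, Finset.sum_map, Finset.card_univ, Fintype.card_prod, Nat.cast_mul,
    mul_inv, mul_assoc, Fintype.sum_prod_type, Finset.mul_sum (a := (Fintype.card Q.nil : ℝ)⁻¹)]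
  rfl

theorem Parabolic.average_res_eq {α β : Type*} [Fintype α] [Fintype β] (Q Q' : Parabolic p)
    (Ψ : p.C) (y : α → Q.L.Lie) (hy : Function.Injective y) (y' : β → Q'.L.Lie)
    (hy' : Function.Injective y')
    (h : ∀ W : p.Lie,
      (∃ a, (W : Matrix (Fin m) (Fin m) F) - (y a : Matrix (Fin m) (Fin m) F) ∈ Q.nil) ↔
      ∃ b, (W : Matrix (Fin m) (Fin m) F) - (y' b : Matrix (Fin m) (Fin m) F) ∈ Q'.nil) :
    (Fintype.card α : ℝ)⁻¹ * ∑ a, (Q.res Ψ : Q.L.Lie → ℝ) (y a) =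
      (Fintype.card β : ℝ)⁻¹ * ∑ b, (Q'.res Ψ : Q'.L.Lie → ℝ) (y' b) := by
  classical
  rw [Q.average_res Ψ y hy (Finset.univ.filter fun W : p.Lie => ∃ a,
      (W : Matrix (Fin m) (Fin m) F) - (y a : Matrix (Fin m) (Fin m) F) ∈ Q.nil) (by simp),
    Q'.average_res Ψ y' hy' (Finset.univ.filter fun W : p.Lie => ∃ a,
      (W : Matrix (Fin m) (Fin m) F) - (y a : Matrix (Fin m) (Fin m) F) ∈ Q.nil) (by simp [h])]

variable [StarRing F] {a b c k n : ℕ} {m : ℕ}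

/-- Both sides average `Ψ` over the same set: the matrices in `𝔲(2n)` that are triangular for the
flag `a, b, 2c, b, a` with diagonal beginning `A, B, C`. -/
theorem res_res (hm : a + b = m) (h : m + c = n) (hk : b + c = k) (h' : a + k = n)
    (Ψ : (uPair F (2 * n)).C) (A : (glPair F a).Lie) (B : (glPair F b).Lie)
    (C : (uPair F (2 * c)).Lie) :
    (Fintype.card (glParabolic F hm).nil : ℝ)⁻¹ * ∑ Z : (glParabolic F hm).nil,
      ((uParabolic F h).res Ψ : (uParabolic F h).L.Lie → ℝ)
        (uParBlock F h (⟨(glParBlock F hm (A, B) : Matrix (Fin m) (Fin m) F) + Z, trivial⟩, C)) =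
    (Fintype.card (uParabolic F hk).nil : ℝ)⁻¹ * ∑ Z : (uParabolic F hk).nil,
      ((uParabolic F h').res Ψ : (uParabolic F h').L.Lie → ℝ)
        (uParBlock F h' (A, ⟨(uParBlock F hk (B, C) : Matrix (Fin (2 * k)) (Fin (2 * k)) F) + Z,
          add_mem ((uParabolic F hk).LieL_le (uParBlock F hk (B, C)).2) ((uParabolic F hk).nil_le Z.2)⟩)) := by
  have hm' : b + a = m := by omega
  refine Parabolic.average_res_eq (uParabolic F h) (uParabolic F h') Ψ
    (fun Z : (glParabolic F hm).nil => uParBlock F h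
      (⟨(glParBlock F hm (A, B) : Matrix (Fin m) (Fin m) F) + Z, trivial⟩, C)) ?_
    (fun Z : (uParabolic F hk).nil => uParBlock F h'
      (A, ⟨(uParBlock F hk (B, C) : Matrix (Fin (2 * k)) (Fin (2 * k)) F) + Z,
          add_mem ((uParabolic F hk).LieL_le (uParBlock F hk (B, C)).2) ((uParabolic F hk).nil_le Z.2)⟩)) ?_ ?_
  · intro Z Z' he
    have := congrArg (fun x => (Prod.fst x).1) ((uParBlock F h).injective he)
    exact Subtype.ext (add_left_cancel this)
  · intro Z Z' he
    have := congrArg (fun x => (Prod.snd x).1) ((uParBlock F h').injective he)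
    exact Subtype.ext (add_left_cancel this)
  · intro W
    refine (exists_congr fun Z => sub_mem_uParabolic_nil h W _).trans
      (Iff.trans ?_ (exists_congr fun Z => (sub_mem_uParabolic_nil h' W _).symm))
    constructor
    · rintro ⟨Z, hZ⟩
      have h1 := (sub_mem_glParabolic_nil hm
        ((glParBlock F hm (A, B) : Matrix (Fin m) (Fin m) F) + (Z : Matrix (Fin m) (Fin m) F)) (A, B)).mp
        (by rw [add_sub_cancel_left]; exact Z.2)
      obtain ⟨N, h2, h3⟩ := hZ.refine_middle hm hm' h hk h' h1 (h1.dualLie hm')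
      -- The refined middle block is in `𝔲(2k)` since `W` is in `𝔲(2n)`.
      have h4 := (h2.of_mem_Lie W.2).1
      have h5 := (sub_mem_uParabolic_nil hk ⟨N, h4⟩ (B, C)).mpr h3
      refine ⟨⟨_, h5⟩, ?_⟩
      simp only [add_sub_cancel]
      exact h2
    · rintro ⟨Z, hZ⟩
      have h0 : IsUp₃ hk (Z : Matrix (Fin (2 * k)) (Fin (2 * k)) F) 0 0 0 := Z.2.2
      have h1 := (isUp₃_uParBlock hk (B, C)).add h0
      simp only [add_zero] at h1
      obtain ⟨M, M', h2, h3, -⟩ := hZ.refine_outer hm hm' h hk h' h1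
      -- The lower right block `M'` is forced to be `dualLie M`, as the parametrization of the Levi
      -- subalgebra requires.
      obtain rfl := (h2.of_mem_Lie W.2).2
      refine ⟨⟨_, (sub_mem_glParabolic_nil hm M (A, B)).mpr h3⟩, ?_⟩
      simp only [add_sub_cancel]
      exact h2

end Restriction

/-! ### Orders of parabolic subgroups and unipotent radicals -/

section Unipotent

/-- By `hf` the cosets `f(v) U` are pairwise disjoint, so `(v, u) ↦ f(v) u` is a bijection onto
their union. -/
theorem card_mul_card_subgroup {Γ α : Type*} [Group Γ] (U : Subgroup Γ) (f : α → Γ)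
    (hf : ∀ v v', (f v)⁻¹ * f v' ∈ U → v = v') :
    Nat.card α * Nat.card U = Nat.card {g : Γ | ∃ v, (f v)⁻¹ * g ∈ U} := by
  rw [← Nat.card_prod]
  refine Nat.card_congr (Equiv.ofBijective (fun x : α × U =>
    (⟨f x.1 * x.2, x.1, by simp⟩ : {g : Γ | ∃ v, (f v)⁻¹ * g ∈ U})) ⟨?_, ?_⟩)
  · rintro ⟨v, u⟩ ⟨v', u'⟩ he
    have h1 : f v * u = f v' * u' := congrArg Subtype.val he
    have h2 : (f v)⁻¹ * f v' = u * (u' : Γ)⁻¹ := by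
      rw [inv_mul_eq_iff_eq_mul, ← mul_assoc, h1, mul_inv_cancel_right]
    obtain rfl := hf v v' (h2 ▸ mul_mem u.2 (inv_mem u'.2))
    exact Prod.ext rfl (Subtype.ext (mul_left_cancel h1))
  · rintro ⟨g, v, hv⟩
    exact ⟨(v, ⟨_, hv⟩), Subtype.ext (mul_inv_cancel_left _ _)⟩

variable {F : Type*} [Field F] {i j n : ℕ}

theorem card_glLevi (h : i + j = n) :
    Nat.card (glLevi F h).G = Nat.card (GL (Fin i) F) * Nat.card (GL (Fin j) F) := by
  rw [← Nat.card_prod]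
  symm
  refine Nat.card_congr (Equiv.ofBijective (fun x : GL (Fin i) F × GL (Fin j) F =>
    (⟨(exists_up₂ h x.1 x.2).choose, x.1, x.2, (exists_up₂ h x.1 x.2).choose_spec⟩ :
      (glLevi F h).G)) ⟨?_, ?_⟩)
  · rintro ⟨A, B⟩ ⟨A', B'⟩ he
    have h1 : (exists_up₂ h A B).choose = (exists_up₂ h A' B').choose := congrArg Subtype.val he
    have h2 := (exists_up₂ h A B).choose_spec
    rw [h1, (exists_up₂ h A' B').choose_spec] at h2
    obtain ⟨h3, -, h4⟩ := up₂_inj h h2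
    exact Prod.ext (Units.ext h3.symm) (Units.ext h4.symm)
  · rintro ⟨g, A, B, hg⟩
    exact ⟨(A, B), Subtype.ext (Units.ext ((exists_up₂ h A B).choose_spec.trans hg.symm))⟩

theorem card_glParabolic [Finite F] (h : i + j = n) :
    Nat.card ((glParabolic F h).P.subgroupOf (glPair F n).G) =
      Nat.card (GL (Fin i) F) * Nat.card (GL (Fin j) F) * Nat.card (glParabolic F h).U := by
  rw [← card_glLevi h]
  refine (glParabolic F h).card_P (Subgroup.disjoint_def.mpr ?_)
  rintro g ⟨A, B, hg⟩ hU
  obtain ⟨h1, h2⟩ := IsUp₂.inj ⟨0, hg⟩ hU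
  apply Units.ext
  rw [hg, h1, h2, up₂_one, Units.val_one]

variable [StarRing F]

/-- The block diagonal matrix `diag(A, B, A')`. -/
def uDiag (h : i + j = n) (A : GL (Fin i) F) (B : GL (Fin (2 * j)) F) : GL (Fin (2 * n)) F :=
  (exists_up₃ h A B).choose

theorem uDiag_val (h : i + j = n) (A : GL (Fin i) F) (B : GL (Fin (2 * j)) F) :
    (uDiag h A B : Matrix (Fin (2 * n)) (Fin (2 * n)) F) = up₃ h A 0 0 B 0 (dual A) :=
  (exists_up₃ h A B).choose_spec

theorem uDiag_mem (h : i + j = n) (A : GL (Fin i) F) {B : GL (Fin (2 * j)) F}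
    (hB : B ∈ (uPair F (2 * j)).G) : uDiag h A B ∈ (uParabolic F h).L.G :=
  ⟨A, B, hB, uDiag_val h A B⟩

theorem isUp₃_uDiag (h : i + j = n) (A : GL (Fin i) F) (B : GL (Fin (2 * j)) F) :
    IsUp₃ h (uDiag h A B : Matrix (Fin (2 * n)) (Fin (2 * n)) F) A B (dual A) :=
  ⟨0, 0, 0, uDiag_val h A B⟩

theorem uDiag_inv (h : i + j = n) (A : GL (Fin i) F) (B : GL (Fin (2 * j)) F) :
    (uDiag h A B)⁻¹ = uDiag h A⁻¹ B⁻¹ :=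
  Units.ext (by rw [up₃_inv h (uDiag_val h A B), uDiag_val])

theorem mem_uParabolic_U (h : i + j = n) (g : GL (Fin (2 * n)) F) :
    g ∈ (uParabolic F h).U ↔ g ∈ (uPair F (2 * n)).G ∧
      IsUp₃ h (g : Matrix (Fin (2 * n)) (Fin (2 * n)) F) 1 1 1 := Iff.rfl

/-- Describes the coset of the unipotent radical through `diag(A, B, A')`: it consists of the
unitary block triangular matrices with this diagonal. -/
theorem uDiag_inv_mul_mem_U (h : i + j = n) (A : GL (Fin i) F) {B : GL (Fin (2 * j)) F}
    (hB : B ∈ (uPair F (2 * j)).G) (g : GL (Fin (2 * n)) F) :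
    (uDiag h A B)⁻¹ * g ∈ (uParabolic F h).U ↔ g ∈ (uPair F (2 * n)).G ∧
      IsUp₃ h (g : Matrix (Fin (2 * n)) (Fin (2 * n)) F) A B (dual A) := by
  have hd := (uParabolic F h).L_le (uDiag_mem h A hB)
  rw [mem_uParabolic_U]
  refine and_congr ((Subgroup.mul_mem_cancel_left _ (inv_mem hd))) ⟨fun h1 => ?_, fun h1 => ?_⟩
  · have := (isUp₃_uDiag h A B).mul h1
    rw [← Units.val_mul, mul_inv_cancel_left] at this
    simpa using this
  · rw [uDiag_inv, Units.val_mul]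
    have := (isUp₃_uDiag h A⁻¹ B⁻¹).mul h1
    rw [dual_inv_mul] at this
    simpa using this

variable {a b c k m : ℕ}

/-- Both products count the unipotent radical of the fine flag. It is a union of cosets of either
coarse unipotent radical, represented by `diag(v, 1, v')` with `v` in the radical for `GL(m)`, or by
`diag(1, w, 1)` with `w` in the radical for `U(2k)`. -/
theorem card_U_mul_card_U (hm : a + b = m) (h : m + c = n) (hk : b + c = k) (h' : a + k = n) :
    Nat.card (glParabolic F hm).U * Nat.card (uParabolic F h).U =
      Nat.card (uParabolic F hk).U * Nat.card (uParabolic F h').U := by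
  have hm' : b + a = m := by omega
  rw [card_mul_card_subgroup (uParabolic F h).U
      (fun v : (glParabolic F hm).U => uDiag h (v : GL (Fin m) F) 1),
    card_mul_card_subgroup (uParabolic F h').U
      (fun w : (uParabolic F hk).U => uDiag h' 1 (w : GL (Fin (2 * k)) F))]
  · congr 2
    ext g
    simp only [Set.mem_ofPred_eq]
    refine (exists_congr fun v => uDiag_inv_mul_mem_U h _ (one_mem _) g).trans
      (Iff.trans ?_ (exists_congr fun w => (uDiag_inv_mul_mem_U h' _ w.2.1 g).symm))
    constructor
    · rintro ⟨v, hg, h1⟩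
      have hv : IsUp₂ hm ((v : GL (Fin m) F) : Matrix (Fin m) (Fin m) F) 1 1 := v.2
      have hv' : IsUp₂ hm (((v : GL (Fin m) F)⁻¹ : GL (Fin m) F) : Matrix (Fin m) (Fin m) F) 1 1 :=
        inv_mem v.2
      -- The lower right block `dual v` is `jadj` of the inverse of `v`, hence unipotent for the
      -- reversed block sizes.
      have hd := hv'.jadj hm'
      rw [← dual_eq_jadj, jadj_one, jadj_one] at hd
      obtain ⟨N, h2, h3⟩ := h1.refine_middle hm hm' h hk h' hv hd
      have h4 := (h2.of_mem_G hg).1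
      -- The equation `jadj N * N = 1` supplies the inverse of `N` and says that it is unitary.
      let w : GL (Fin (2 * k)) F := ⟨N, jadj N, mul_eq_one_comm.mp h4, h4⟩
      exact ⟨⟨w, (mem_uPair_G_iff w).mpr h4, h3⟩, hg, by rw [dual_one]; exact h2⟩
    · rintro ⟨w, hg, h1⟩
      rw [dual_one] at h1
      obtain ⟨M, M', h2, h3, -⟩ := h1.refine_outer hm hm' h hk h' w.2.2
      have h4 := (h2.of_mem_G hg).2
      obtain ⟨C, rfl⟩ := h3
      let v : GL (Fin m) F := ⟨up₂ hm 1 C 1, up₂ hm 1 (-C) 1,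
        by rw [up₂_mul, ← up₂_one hm]; simp, by rw [up₂_mul, ← up₂_one hm]; simp⟩
      -- Both matrices are inverse to `jadj v`: `dual v` from the left, `M'` from the right by
      -- unitarity of `g`.
      have h5 : dual v = M' := by
        have h6 : dual v * jadj (v : Matrix (Fin m) (Fin m) F) = 1 := by
          rw [dual_eq_jadj, ← jadj_mul, Units.mul_inv, jadj_one]
        calc dual v = dual v * (jadj (v : Matrix (Fin m) (Fin m) F) * M') := by
              rw [show jadj (v : Matrix (Fin m) (Fin m) F) * M' = 1 from h4, mul_one]
          _ = M' := by rw [← mul_assoc, h6, one_mul]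
      exact ⟨⟨v, C, rfl⟩, hg, by rw [h5]; exact h2⟩
  · intro w w' hw
    rw [uDiag_inv_mul_mem_U h' _ w.2.1] at hw
    exact Subtype.ext (Units.ext (hw.2.inj (isUp₃_uDiag h' 1 (w' : GL (Fin (2 * k)) F))).2.1)
  · intro v v' hv
    rw [uDiag_inv_mul_mem_U h _ (one_mem _)] at hv
    exact Subtype.ext (Units.ext (hv.2.inj (isUp₃_uDiag h (v' : GL (Fin m) F) 1)).1)

theorem card_uLevi (h : i + j = n) :
    Nat.card (uLevi F h).G = Nat.card (GL (Fin i) F) * Nat.card (uPair F (2 * j)).G := by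
  rw [← Nat.card_prod]
  symm
  refine Nat.card_congr (Equiv.ofBijective (fun x : GL (Fin i) F × (uPair F (2 * j)).G =>
    (⟨uDiag h x.1 x.2, uDiag_mem h x.1 x.2.2⟩ : (uLevi F h).G)) ⟨?_, ?_⟩)
  · rintro ⟨A, B⟩ ⟨A', B'⟩ he
    have h1 : uDiag h A (B : GL (Fin (2 * j)) F) = uDiag h A' B' := congrArg Subtype.val he
    have h2 := (isUp₃_uDiag h A (B : GL (Fin (2 * j)) F)).inj (h1 ▸ isUp₃_uDiag h A' B')
    exact Prod.ext (Units.ext h2.1) (Subtype.ext (Units.ext h2.2.1))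
  · rintro ⟨g, A, B, hB, hg⟩
    exact ⟨(A, ⟨B, hB⟩), Subtype.ext (Units.ext ((uDiag_val h A B).trans hg.symm))⟩

/-- Expresses conjugations in one factor as conjugations by Levi elements, which is what
`Parabolic.ind_of_average` needs. -/
theorem Ad_uDiag (h : i + j = n) (A : (glPair F i).G) (B : (uPair F (2 * j)).G)
    (X : (glPair F i).Lie) (Y : (uPair F (2 * j)).Lie) :
    (uParabolic F h).L.Ad ⟨uDiag h A B, uDiag_mem h A B.2⟩ (uParBlock F h (X, Y)) =
      uParBlock F h ((glPair F i).Ad A X, (uPair F (2 * j)).Ad B Y) := by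
  apply Subtype.ext
  change (uDiag h (A : GL (Fin i) F) (B : GL (Fin (2 * j)) F) : Matrix _ _ F) *
    up₃ h X 0 0 Y 0 (dualLie (X : Matrix (Fin i) (Fin i) F)) * _ = up₃ h _ 0 0 _ 0 (dualLie _)
  simp only [LiePair.Ad, dualLie_conj]
  rw [up₃_inv h (uDiag_val h _ _), uDiag_val, up₃_mul, up₃_mul]
  simp

variable [Finite F]

theorem card_uParabolic (h : i + j = n) :
    Nat.card ((uParabolic F h).P.subgroupOf (uPair F (2 * n)).G) =
      Nat.card (GL (Fin i) F) * Nat.card (uPair F (2 * j)).G * Nat.card (uParabolic F h).U := by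
  rw [← card_uLevi h]
  refine (uParabolic F h).card_P (Subgroup.disjoint_def.mpr ?_)
  rintro g ⟨A, B, hB, hg⟩ ⟨-, hU⟩
  obtain ⟨h1, h2, h3⟩ := IsUp₃.inj ⟨0, 0, 0, hg⟩ hU
  apply Units.ext
  rw [hg, h1, h2, h3, up₃_one, Units.val_one]

end Unipotent

/-! ### Transitivity of parabolic induction -/

section Induction

variable {F : Type*} [Field F] [Finite F] {i j n a b c k m : ℕ}

/-- The external product as a map to the invariant functions on the Levi subalgebra of the
parabolic. -/
def glParTensor (F : Type*) [Field F] [Finite F] {i j n : ℕ} (h : i + j = n) :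
    (glPair F i).C ⊗[ℝ] (glPair F j).C ≃ₗ[ℝ] (glParabolic F h).L.C := glTensor F h

theorem glParTensor_apply (h : i + j = n) (t : (glPair F i).C ⊗[ℝ] (glPair F j).C)
    (X : (glPair F i).Lie × (glPair F j).Lie) :
    (glParTensor F h t : (glParabolic F h).L.Lie → ℝ) (glParBlock F h X) =
      (evalLeft (glPair F i) (glPair F j).C X.1 t : (glPair F j).Lie → ℝ) X.2 := by
  unfold glParTensor glTensor
  exact boxEquiv_apply (glPair F i) (glPair F j) (glLevi F h) (glBlock F h) _ _ t X.1 X.2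

theorem glParTensor_tmul (h : i + j = n) (φ : (glPair F i).C) (ψ : (glPair F j).C)
    (X : (glPair F i).Lie × (glPair F j).Lie) :
    (glParTensor F h (φ ⊗ₜ ψ) : (glParabolic F h).L.Lie → ℝ) (glParBlock F h X) =
      (φ : (glPair F i).Lie → ℝ) X.1 * (ψ : (glPair F j).Lie → ℝ) X.2 := by
  rw [glParTensor_apply, evalLeft_tmul]
  rfl

variable [StarRing F]

/-- The external product as a map to the invariant functions on the Levi subalgebra of the
parabolic. -/
def uParTensor (F : Type*) [Field F] [Finite F] [StarRing F] {i j n : ℕ} (h : i + j = n) :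
    (glPair F i).C ⊗[ℝ] (uPair F (2 * j)).C ≃ₗ[ℝ] (uParabolic F h).L.C := uTensor F h

theorem uParTensor_apply (h : i + j = n) (t : (glPair F i).C ⊗[ℝ] (uPair F (2 * j)).C)
    (X : (glPair F i).Lie × (uPair F (2 * j)).Lie) :
    (uParTensor F h t : (uParabolic F h).L.Lie → ℝ) (uParBlock F h X) =
      (evalLeft (glPair F i) (uPair F (2 * j)).C X.1 t : (uPair F (2 * j)).Lie → ℝ) X.2 := by
  unfold uParTensor uTensor
  exact boxEquiv_apply (glPair F i) (uPair F (2 * j)) (uLevi F h) (uBlock F h) _ _ t X.1 X.2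

theorem uParTensor_tmul (h : i + j = n) (φ : (glPair F i).C) (ψ : (uPair F (2 * j)).C)
    (X : (glPair F i).Lie × (uPair F (2 * j)).Lie) :
    (uParTensor F h (φ ⊗ₜ ψ) : (uParabolic F h).L.Lie → ℝ) (uParBlock F h X) =
      (φ : (glPair F i).Lie → ℝ) X.1 * (ψ : (uPair F (2 * j)).Lie → ℝ) X.2 := by
  rw [uParTensor_apply, evalLeft_tmul]
  rfl

/-- The extension by zero for the flag with block sizes `a, b, 2c, b, a` can be computed through
either of the two intermediate flags. -/
theorem extend_extend (hm : a + b = m) (h : m + c = n) (hk : b + c = k) (h' : a + k = n)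
    (φ : (glPair F a).C) (φ' : (glPair F b).C) (ψ : (uPair F (2 * c)).C)
    (W : (uPair F (2 * n)).Lie) :
    (uParabolic F h).extend (fun Y => (glParabolic F hm).extend (glParTensor F hm (φ ⊗ₜ φ'))
        ((uParBlock F h).symm Y).1 * (ψ : (uPair F (2 * c)).Lie → ℝ) ((uParBlock F h).symm Y).2) W =
      (uParabolic F h').extend (fun Y => (φ : (glPair F a).Lie → ℝ) ((uParBlock F h').symm Y).1 *
        (uParabolic F hk).extend (uParTensor F hk (φ' ⊗ₜ ψ)) ((uParBlock F h').symm Y).2) W := by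
  have hm' : b + a = m := by omega
  -- A dichotomy: either `W` is triangular for the fine flag, and both routes see the same `A`, `B`,
  -- `C`, or neither route admits a decomposition.
  have key : (∃ (M : (glPair F m).Lie) (A : (glPair F a).Lie) (B : (glPair F b).Lie)
      (C : (uPair F (2 * c)).Lie), IsUp₃ h (W : Matrix (Fin (2 * n)) (Fin (2 * n)) F) M C
        (dualLie (M : Matrix (Fin m) (Fin m) F)) ∧ IsUp₂ hm (M : Matrix (Fin m) (Fin m) F) A B ∧
      ∃ (N : (uPair F (2 * k)).Lie), IsUp₃ h' (W : Matrix (Fin (2 * n)) (Fin (2 * n)) F) A N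
        (dualLie (A : Matrix (Fin a) (Fin a) F)) ∧
        IsUp₃ hk (N : Matrix (Fin (2 * k)) (Fin (2 * k)) F) B C
          (dualLie (B : Matrix (Fin b) (Fin b) F))) ∨
      (∀ (M : (glPair F m).Lie) (A : (glPair F a).Lie) (B : (glPair F b).Lie)
        (C : (uPair F (2 * c)).Lie), IsUp₃ h (W : Matrix (Fin (2 * n)) (Fin (2 * n)) F) M C
        (dualLie (M : Matrix (Fin m) (Fin m) F)) →
          ¬ IsUp₂ hm (M : Matrix (Fin m) (Fin m) F) A B) ∧
      (∀ (A : (glPair F a).Lie) (B : (glPair F b).Lie) (C : (uPair F (2 * c)).Lie)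
        (N : (uPair F (2 * k)).Lie), IsUp₃ h' (W : Matrix (Fin (2 * n)) (Fin (2 * n)) F) A N
        (dualLie (A : Matrix (Fin a) (Fin a) F)) →
        ¬ IsUp₃ hk (N : Matrix (Fin (2 * k)) (Fin (2 * k)) F) B C
          (dualLie (B : Matrix (Fin b) (Fin b) F))) := by
    by_cases hex : ∃ (M : (glPair F m).Lie) (A : (glPair F a).Lie) (B : (glPair F b).Lie)
      (C : (uPair F (2 * c)).Lie), IsUp₃ h (W : Matrix (Fin (2 * n)) (Fin (2 * n)) F) M C
        (dualLie (M : Matrix (Fin m) (Fin m) F)) ∧ IsUp₂ hm (M : Matrix (Fin m) (Fin m) F) A B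
    · left
      obtain ⟨M, A, B, C, h1, h2⟩ := hex
      obtain ⟨N, h3, h4⟩ := h1.refine_middle hm hm' h hk h' h2 (h2.dualLie hm')
      exact ⟨M, A, B, C, h1, h2, ⟨N, (h3.of_mem_Lie W.2).1⟩, h3, h4⟩
    · right
      refine ⟨fun M A B C h1 h2 => hex ⟨M, A, B, C, h1, h2⟩, fun A B C N h1 h2 => ?_⟩
      obtain ⟨M, M', h3, h4, -⟩ := h1.refine_outer hm hm' h hk h' h2
      obtain rfl := (h3.of_mem_Lie W.2).2
      exact hex ⟨⟨M, trivial⟩, A, B, C, h3, h4⟩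
  rcases key with ⟨M, A, B, C, h1, h2, N, h3, h4⟩ | ⟨hL, hR⟩
  · rw [(uParabolic F h).extend_eq _ W (uParBlock F h (M, C))
        ((sub_mem_uParabolic_nil h W (M, C)).mpr h1),
      (uParabolic F h').extend_eq _ W (uParBlock F h' (A, N))
        ((sub_mem_uParabolic_nil h' W (A, N)).mpr h3)]
    simp only [Equiv.symm_apply_apply]
    rw [(glParabolic F hm).extend_eq _ M (glParBlock F hm (A, B))
        ((sub_mem_glParabolic_nil hm M (A, B)).mpr h2),
      (uParabolic F hk).extend_eq _ N (uParBlock F hk (B, C))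
        ((sub_mem_uParabolic_nil hk N (B, C)).mpr h4)]
    rw [glParTensor_tmul, uParTensor_tmul, mul_assoc]
  -- Off the fine parabolic subalgebra each side vanishes: either the outer extension is zero or the
  -- inner one is.
  · trans (0 : ℝ)
    · by_cases hex : ∃ Y : (uParabolic F h).L.Lie, (W : Matrix (Fin (2 * n)) (Fin (2 * n)) F) -
          (Y : Matrix (Fin (2 * n)) (Fin (2 * n)) F) ∈ (uParabolic F h).nil
      · obtain ⟨Y, hY⟩ := hex
        obtain ⟨⟨M, C⟩, rfl⟩ := (uParBlock F h).surjective Y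
        rw [(uParabolic F h).extend_eq _ W _ hY]
        simp only [Equiv.symm_apply_apply]
        rw [(glParabolic F hm).extend_eq_zero, zero_mul]
        rintro ⟨Z, hZ⟩
        obtain ⟨⟨A, B⟩, rfl⟩ := (glParBlock F hm).surjective Z
        exact hL M A B C ((sub_mem_uParabolic_nil h W (M, C)).mp hY)
          ((sub_mem_glParabolic_nil hm M (A, B)).mp hZ)
      · exact (uParabolic F h).extend_eq_zero _ W hex
    · symm
      by_cases hex : ∃ Y : (uParabolic F h').L.Lie, (W : Matrix (Fin (2 * n)) (Fin (2 * n)) F) -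
          (Y : Matrix (Fin (2 * n)) (Fin (2 * n)) F) ∈ (uParabolic F h').nil
      · obtain ⟨Y, hY⟩ := hex
        obtain ⟨⟨A, N⟩, rfl⟩ := (uParBlock F h').surjective Y
        rw [(uParabolic F h').extend_eq _ W _ hY]
        simp only [Equiv.symm_apply_apply]
        rw [(uParabolic F hk).extend_eq_zero, mul_zero]
        rintro ⟨Z, hZ⟩
        obtain ⟨⟨B, C⟩, rfl⟩ := (uParBlock F hk).surjective Z
        exact hR A B C N ((sub_mem_uParabolic_nil h' W (A, N)).mp hY)
          ((sub_mem_uParabolic_nil hk N (B, C)).mp hZ)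
      · exact (uParabolic F h').extend_eq_zero _ W hex

/-- The inner inductions are averages over `GL(m)` and `U(2k)`. Absorbed into the outer sum over
`U(2n)`, they leave the two sides of `extend_extend`, and only the scalar factors remain to be
compared. -/
theorem ind_ind (hm : a + b = m) (h : m + c = n) (hk : b + c = k) (h' : a + k = n)
    (φ : (glPair F a).C) (φ' : (glPair F b).C) (ψ : (uPair F (2 * c)).C) :
    (uParabolic F h).ind (uParTensor F h ((glParabolic F hm).ind (glParTensor F hm (φ ⊗ₜ φ')) ⊗ₜ ψ)) =
      (uParabolic F h').ind (uParTensor F h' (φ ⊗ₜ (uParabolic F hk).ind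
        (uParTensor F hk (φ' ⊗ₜ ψ)))) := by
  apply Subtype.ext
  funext X
  rw [(uParabolic F h).ind_of_average _
      (Nat.card ((glParabolic F hm).P.subgroupOf (glPair F m).G) : ℝ)⁻¹
      (fun g : (glPair F m).G => ⟨uDiag h (g⁻¹ : (glPair F m).G) 1,
        uDiag_mem h _ (one_mem _)⟩)
      (fun Y => (glParabolic F hm).extend (glParTensor F hm (φ ⊗ₜ φ'))
        ((uParBlock F h).symm Y).1 * (ψ : (uPair F (2 * c)).Lie → ℝ) ((uParBlock F h).symm Y).2),
    (uParabolic F h').ind_of_average _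
      (Nat.card ((uParabolic F hk).P.subgroupOf (uPair F (2 * k)).G) : ℝ)⁻¹
      (fun g : (uPair F (2 * k)).G => ⟨uDiag h' 1 (g⁻¹ : (uPair F (2 * k)).G),
        uDiag_mem h' _ (g⁻¹).2⟩)
      (fun Y => (φ : (glPair F a).Lie → ℝ) ((uParBlock F h').symm Y).1 *
        (uParabolic F hk).extend (uParTensor F hk (φ' ⊗ₜ ψ)) ((uParBlock F h').symm Y).2)]
  · simp only [extend_extend hm h hk h']
    congr 1
    -- The orders of `GL(m)` and `U(2k)` cancel against the sizes of the inner averages. Each side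
    -- becomes the inverse of `|GL(a)| |GL(b)| |U(2c)|` times the orders of its two unipotent
    -- radicals, and `hU` identifies these.
    rw [card_uParabolic, card_uParabolic, card_uParabolic, card_glParabolic]
    have hU : (Nat.card (glParabolic F hm).U : ℝ) * Nat.card (uParabolic F h).U =
      Nat.card (uParabolic F hk).U * Nat.card (uParabolic F h').U := by
      exact_mod_cast card_U_mul_card_U hm h hk h'
    have hG : Fintype.card (glPair F m).G = Nat.card (GL (Fin m) F) := by
      rw [← Nat.card_eq_fintype_card]
      exact Nat.card_congr Subgroup.topEquiv.toEquiv
    have hG' : Fintype.card (uPair F (2 * k)).G = Nat.card (uPair F (2 * k)).G :=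
      Nat.card_eq_fintype_card.symm
    rw [hG, hG']
    have pos : ∀ {l : ℕ} (G : Subgroup (GL (Fin l) F)), (Nat.card G : ℝ) ≠ 0 := fun G => by
      exact_mod_cast Nat.card_pos.ne'
    have pos' : ∀ l : ℕ, (Nat.card (GL (Fin l) F) : ℝ) ≠ 0 := fun l => by
      exact_mod_cast Nat.card_pos.ne'
    have p1 := pos (glParabolic F hm).U
    have p2 := pos (uParabolic F h).U
    have p3 := pos (uParabolic F hk).U
    have p4 := pos (uParabolic F h').U
    have p5 := pos (uPair F (2 * c)).G
    have p6 := pos (uPair F (2 * k)).G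
    have p7 := pos' a
    have p8 := pos' b
    have p9 := pos' m
    push_cast
    field_simp
    linear_combination -hU
  · intro Y
    obtain ⟨⟨A, N⟩, rfl⟩ := (uParBlock F h').surjective Y
    have h1 : ∀ g : (uPair F (2 * k)).G, (uParabolic F h').L.Ad
        ⟨uDiag h' 1 (g⁻¹ : (uPair F (2 * k)).G), uDiag_mem h' _ (g⁻¹).2⟩ (uParBlock F h' (A, N)) =
        uParBlock F h' (A, (uPair F (2 * k)).Ad g⁻¹ N) := by
      intro g
      have := Ad_uDiag h' (1 : (glPair F a).G) g⁻¹ A N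
      rw [LiePair.Ad_one] at this
      exact this
    simp only [h1, Equiv.symm_apply_apply]
    rw [uParTensor_tmul, Parabolic.ind_apply, mul_left_comm, ← Finset.mul_sum]
  · intro Y
    obtain ⟨⟨M, C⟩, rfl⟩ := (uParBlock F h).surjective Y
    have h1 : ∀ g : (glPair F m).G, (uParabolic F h).L.Ad
        ⟨uDiag h (g⁻¹ : (glPair F m).G) 1, uDiag_mem h _ (one_mem _)⟩ (uParBlock F h (M, C)) =
        uParBlock F h ((glPair F m).Ad g⁻¹ M, C) := by
      intro g
      have := Ad_uDiag h g⁻¹ (1 : (uPair F (2 * c)).G) M C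
      rw [LiePair.Ad_one] at this
      exact this
    simp only [h1, Equiv.symm_apply_apply]
    rw [uParTensor_tmul, Parabolic.ind_apply, ← Finset.sum_mul, mul_assoc]

end Induction

/-! ### Outer blocks of size zero -/

section Trivial

variable {F : Type*} [Field F] {n : ℕ}

/-- With empty outer blocks the middle block is the whole matrix, at offset `0`; hence the
nilradical is zero and the Levi subgroup is all of `U(2n)`. -/
theorem up₃_zero_left (h : 0 + n = n) (Y : Matrix (Fin (2 * n)) (Fin (2 * n)) F)
    (A : Matrix (Fin 0) (Fin 0) F) (C D C' E) : up₃ h A C D Y C' E = Y := by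
  obtain ⟨-, h2, -⟩ := (isUp₃_iff h (W := up₃ h A C D Y C' E)).mp ⟨C, D, C', rfl⟩
  ext r s
  rw [← h2 r s]
  congr 1 <;> ext <;> simp

variable [StarRing F]

theorem uParabolic_zero_nil (h : 0 + n = n) : (uParabolic F h).nil = ⊥ := by
  rw [eq_bot_iff]
  rintro _ ⟨-, C, D, C', rfl⟩
  exact up₃_zero_left h _ _ _ _ _ _

theorem uParBlock_zero (h : 0 + n = n) (A : (glPair F 0).Lie) (Y : (uPair F (2 * n)).Lie) :
    (uParBlock F h (A, Y) : Matrix (Fin (2 * n)) (Fin (2 * n)) F) = Y :=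
  up₃_zero_left h _ _ _ _ _ _

variable [Finite F]

theorem res_zero (h : 0 + n = n) (Ψ : (uPair F (2 * n)).C) (A : (glPair F 0).Lie)
    (Y : (uPair F (2 * n)).Lie) :
    ((uParabolic F h).res Ψ : (uParabolic F h).L.Lie → ℝ) (uParBlock F h (A, Y)) =
      (Ψ : (uPair F (2 * n)).Lie → ℝ) Y := by
  have hz : ∀ Z : (uParabolic F h).nil, (Z : Matrix (Fin (2 * n)) (Fin (2 * n)) F) = 0 := by
    intro Z
    exact AddSubgroup.mem_bot.mp ((uParabolic_zero_nil h).le Z.2)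
  change (Fintype.card (uParabolic F h).nil : ℝ)⁻¹ * ∑ Z : (uParabolic F h).nil,
    (Ψ : (uPair F (2 * n)).Lie → ℝ) _ = _
  rw [Finset.sum_congr rfl (g := fun _ => (Ψ : (uPair F (2 * n)).Lie → ℝ) Y)]
  · have hc : (Fintype.card (uParabolic F h).nil : ℝ) ≠ 0 := by
      exact_mod_cast Fintype.card_ne_zero
    rw [Finset.sum_const, nsmul_eq_mul, Finset.card_univ, inv_mul_cancel_left₀ hc]
  · intro Z _
    refine congrArg (Ψ : (uPair F (2 * n)).Lie → ℝ) (Subtype.ext ?_)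
    simp only [hz Z, add_zero]
    exact uParBlock_zero h A Y

/-- Here `P = G`, and the summand is constant in `g` since `ψ` is invariant, so the average over `G`
returns the function itself. -/
theorem ind_zero (h : 0 + n = n) (φ : (glPair F 0).C) (ψ : (uPair F (2 * n)).C) :
    (uParabolic F h).ind (uParTensor F h (φ ⊗ₜ ψ)) = (φ : (glPair F 0).Lie → ℝ) 0 • ψ := by
  apply Subtype.ext
  funext X
  have hP : (uParabolic F h).P.subgroupOf (uPair F (2 * n)).G = ⊤ := by
    rw [Subgroup.subgroupOf_eq_top]
    intro g hg
    exact (le_sup_left : (uLevi F h).G ≤ (uParabolic F h).P)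
      ⟨1, g, hg, (up₃_zero_left h _ _ _ _ _ _).symm⟩
  have hE : ∀ g : (uPair F (2 * n)).G, (uParabolic F h).extend (uParTensor F h (φ ⊗ₜ ψ))
      ((uPair F (2 * n)).Ad g⁻¹ X) =
      (φ : (glPair F 0).Lie → ℝ) 0 * (ψ : (uPair F (2 * n)).Lie → ℝ) X := by
    intro g
    rw [(uParabolic F h).extend_eq _ _ (uParBlock F h (0, (uPair F (2 * n)).Ad g⁻¹ X)),
      uParTensor_tmul, ψ.2]
    rw [uParBlock_zero, sub_self]
    exact zero_mem _
  rw [Parabolic.ind_apply, hP]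
  simp only [hE]
  have hc : (Nat.card (uPair F (2 * n)).G : ℝ) ≠ 0 := by exact_mod_cast Nat.card_pos.ne'
  rw [Subgroup.card_top, Finset.sum_const, nsmul_eq_mul, Finset.card_univ,
    ← Nat.card_eq_fintype_card, inv_mul_cancel_left₀ hc]
  rfl

end Trivial

/-! ### Coassociativity on homogeneous components -/

section Coaction

variable {F : Type*} [Field F] {a b c i j k m n : ℕ}

theorem evalLeft_map_id (p : LiePair F m) {V W : Type*} [AddCommGroup V] [Module ℝ V]
    [AddCommGroup W] [Module ℝ W] (T : V →ₗ[ℝ] W) (s : p.C ⊗[ℝ] V) (X : p.Lie) :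
    evalLeft p W X (TensorProduct.map LinearMap.id T s) = T (evalLeft p V X s) := by
  induction s with
  | zero => simp
  | add x y hx hy => simp [hx, hy]
  | tmul φ v => simp [evalLeft_tmul]

variable [Finite F]

/-- Parabolic restriction `𝒞(𝔤𝔩(n)) → 𝒞(𝔤𝔩(i)) ⊗ 𝒞(𝔤𝔩(j))`. -/
def glRes (F : Type*) [Field F] [Finite F] {i j n : ℕ} (h : i + j = n) :
    (glPair F n).C →ₗ[ℝ] (glPair F i).C ⊗[ℝ] (glPair F j).C :=
  (glParTensor F h).symm.toLinearMap ∘ₗ (glParabolic F h).res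

theorem evalLeft_glRes (h : i + j = n) (Φ : (glPair F n).C) (A : (glPair F i).Lie)
    (B : (glPair F j).Lie) :
    (evalLeft (glPair F i) (glPair F j).C A (glRes F h Φ) : (glPair F j).Lie → ℝ) B =
      (Fintype.card (glParabolic F h).nil : ℝ)⁻¹ * ∑ Z : (glParabolic F h).nil,
        (Φ : (glPair F n).Lie → ℝ)
          ⟨(glParBlock F h (A, B) : Matrix (Fin n) (Fin n) F) + Z, trivial⟩ := by
  rw [← glParTensor_apply h (glRes F h Φ) (A, B), glRes, LinearMap.comp_apply,
    LinearEquiv.coe_coe, LinearEquiv.apply_symm_apply]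
  rfl

/-- Restriction in the first tensor factor, evaluated at two points, averages the evaluations of `s`
over the nilradical; by linearity this follows from `evalLeft_glRes` on pure tensors. -/
theorem evalLeft_assoc_glRes {V : Type*} [AddCommGroup V] [Module ℝ V] (h : i + j = n)
    (s : (glPair F n).C ⊗[ℝ] V) (A : (glPair F i).Lie) (B : (glPair F j).Lie) :
    evalLeft (glPair F j) V B (evalLeft (glPair F i) ((glPair F j).C ⊗[ℝ] V) A
      (TensorProduct.assoc ℝ _ _ _ (TensorProduct.map (glRes F h) LinearMap.id s))) =
    (Fintype.card (glParabolic F h).nil : ℝ)⁻¹ • ∑ Z : (glParabolic F h).nil,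
      evalLeft (glPair F n) V
        ⟨(glParBlock F h (A, B) : Matrix (Fin n) (Fin n) F) + Z, trivial⟩ s := by
  have h1 : ∀ (t : (glPair F i).C ⊗[ℝ] (glPair F j).C) (v : V),
      evalLeft (glPair F j) V B (evalLeft (glPair F i) ((glPair F j).C ⊗[ℝ] V) A
        (TensorProduct.assoc ℝ _ _ _ (t ⊗ₜ v))) =
      (evalLeft (glPair F i) (glPair F j).C A t : (glPair F j).Lie → ℝ) B • v := by
    intro t v
    induction t with
    | zero =>
      rw [TensorProduct.zero_tmul]
      simp only [LinearMap.map_zero, LinearEquiv.map_zero, Submodule.coe_zero, Pi.zero_apply,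
        zero_smul]
    | add x y hx hy =>
      rw [TensorProduct.add_tmul]
      simp only [LinearMap.map_add, LinearEquiv.map_add, hx, hy, Submodule.coe_add, Pi.add_apply,
        add_smul]
    | tmul φ φ' => simp [evalLeft_tmul, mul_smul]
  induction s with
  | zero =>
    simp only [LinearMap.map_zero, LinearEquiv.map_zero, Finset.sum_const_zero, smul_zero]
  | add x y hx hy =>
    simp only [LinearMap.map_add, LinearEquiv.map_add, hx, hy, Finset.sum_add_distrib, smul_add]
  | tmul φ v =>
    rw [TensorProduct.map_tmul, LinearMap.id_apply, h1, evalLeft_glRes]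
    simp only [evalLeft_tmul, ← Finset.sum_smul, mul_smul]

variable [StarRing F]

/-- Parabolic restriction `𝒞(𝔲(2n)) → 𝒞(𝔤𝔩(i)) ⊗ 𝒞(𝔲(2j))`. -/
def uRes (F : Type*) [Field F] [Finite F] [StarRing F] {i j n : ℕ} (h : i + j = n) :
    (uPair F (2 * n)).C →ₗ[ℝ] (glPair F i).C ⊗[ℝ] (uPair F (2 * j)).C :=
  (uParTensor F h).symm.toLinearMap ∘ₗ (uParabolic F h).res

theorem evalLeft_uRes (h : i + j = n) (Ψ : (uPair F (2 * n)).C) (A : (glPair F i).Lie)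
    (B : (uPair F (2 * j)).Lie) :
    (evalLeft (glPair F i) (uPair F (2 * j)).C A (uRes F h Ψ) : (uPair F (2 * j)).Lie → ℝ) B =
      ((uParabolic F h).res Ψ : (uParabolic F h).L.Lie → ℝ) (uParBlock F h (A, B)) := by
  rw [← uParTensor_apply h (uRes F h Ψ) (A, B), uRes, LinearMap.comp_apply,
    LinearEquiv.coe_coe, LinearEquiv.apply_symm_apply]

/-- Evaluating all three tensor factors at `A`, `B`, `C` turns the claim into `res_res`. -/
theorem uRes_coassoc (hm : a + b = m) (h : m + c = n) (hk : b + c = k) (h' : a + k = n)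
    (Ψ : (uPair F (2 * n)).C) :
    TensorProduct.assoc ℝ _ _ _ (TensorProduct.map (glRes F hm) LinearMap.id (uRes F h Ψ)) =
      TensorProduct.map LinearMap.id (uRes F hk) (uRes F h' Ψ) := by
  refine evalLeft_injective _ fun A => evalLeft_injective _ fun B => Subtype.ext (funext fun C => ?_)
  rw [evalLeft_assoc_glRes, evalLeft_map_id, evalLeft_uRes]
  simp only [Submodule.coe_smul, Submodule.coe_sum, Pi.smul_apply, Finset.sum_apply, smul_eq_mul,
    evalLeft_uRes]
  rw [res_res hm h hk h']
  -- With `A` fixed, the summands are values of one function in `𝒞(𝔲(2k))`, so the average over the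
  -- nilradical is its parabolic restriction.
  simp only [← evalLeft_uRes]
  rw [evalLeft_uRes]
  rfl

end Coaction

/-! ### Tensor products of maps given as sums of components -/

section Tensor

variable {ι M P V V' W W' : Type*} {X Y : ι → Type*} [Fintype ι] [AddCommMonoid M] [Module ℝ M]
  [AddCommMonoid P] [Module ℝ P] [AddCommMonoid V] [Module ℝ V] [AddCommMonoid V'] [Module ℝ V']
  [AddCommMonoid W] [Module ℝ W] [AddCommMonoid W'] [Module ℝ W']
  [∀ i, AddCommMonoid (X i)] [∀ i, Module ℝ (X i)] [∀ i, AddCommMonoid (Y i)] [∀ i, Module ℝ (Y i)]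

/-- Serves to apply `Δ ⊗ id` to a homogeneous component: `d` is `Δ`, `g` and `h` are inclusions of
graded parts, and the `δ i` are the individual restrictions. -/
theorem assoc_map_map_of_sum (g : M →ₗ[ℝ] V) (h : P →ₗ[ℝ] W) (d : V →ₗ[ℝ] V' ⊗[ℝ] W')
    (f : ∀ i, X i →ₗ[ℝ] V') (f' : ∀ i, Y i →ₗ[ℝ] W') (δ : ∀ i, M →ₗ[ℝ] X i ⊗[ℝ] Y i)
    (hd : ∀ x, d (g x) = ∑ i, TensorProduct.map (f i) (f' i) (δ i x)) (t : M ⊗[ℝ] P) :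
    TensorProduct.assoc ℝ V' W' W (TensorProduct.map d LinearMap.id (TensorProduct.map g h t)) =
      ∑ i, TensorProduct.map (f i) (TensorProduct.map (f' i) h)
        (TensorProduct.assoc ℝ _ _ _ (TensorProduct.map (δ i) LinearMap.id t)) := by
  induction t with
  | zero => simp only [LinearMap.map_zero, LinearEquiv.map_zero, Finset.sum_const_zero]
  | add x y hx hy =>
    simp only [LinearMap.map_add, LinearEquiv.map_add, hx, hy, Finset.sum_add_distrib]
  | tmul x y =>
    simp only [TensorProduct.map_map_assoc, TensorProduct.map_tmul, hd, TensorProduct.sum_tmul,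
      map_sum, LinearMap.id_apply]

theorem map_map_of_sum (g : M →ₗ[ℝ] V) (h : P →ₗ[ℝ] W) (d : W →ₗ[ℝ] V' ⊗[ℝ] W')
    (f : ∀ i, X i →ₗ[ℝ] V') (f' : ∀ i, Y i →ₗ[ℝ] W') (δ : ∀ i, P →ₗ[ℝ] X i ⊗[ℝ] Y i)
    (hd : ∀ x, d (h x) = ∑ i, TensorProduct.map (f i) (f' i) (δ i x)) (t : M ⊗[ℝ] P) :
    TensorProduct.map LinearMap.id d (TensorProduct.map g h t) =
      ∑ i, TensorProduct.map g (TensorProduct.map (f i) (f' i))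
        (TensorProduct.map LinearMap.id (δ i) t) := by
  induction t with
  | zero => simp only [LinearMap.map_zero, Finset.sum_const_zero]
  | add x y hx hy => simp only [LinearMap.map_add, hx, hy, Finset.sum_add_distrib]
  | tmul x y =>
    simp only [TensorProduct.map_tmul, hd, TensorProduct.tmul_sum, LinearMap.id_apply]

end Tensor

/-! ### Assembling the graded module and comodule -/

section Graded

/-- Both double sums run over the triples with `a + b + c = n`, grouped by `a + b` on the left and
by `b + c` on the right. -/
theorem sum_antidiagonal_antidiagonal_fst {M : Type*} [AddCommMonoid M] (n : ℕ)
    (f : ℕ → ℕ → ℕ → M) :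
    ∑ p ∈ Finset.HasAntidiagonal.antidiagonal n, ∑ q ∈ Finset.HasAntidiagonal.antidiagonal p.1, f q.1 q.2 p.2 =
      ∑ p ∈ Finset.HasAntidiagonal.antidiagonal n, ∑ q ∈ Finset.HasAntidiagonal.antidiagonal p.2, f p.1 q.1 q.2 := by
  rw [Finset.sum_sigma', Finset.sum_sigma']
  refine Finset.sum_nbij' (fun x => ⟨(x.2.1, x.2.2 + x.1.2), (x.2.2, x.1.2)⟩)
    (fun x => ⟨(x.1.1 + x.2.1, x.2.2), (x.1.1, x.2.1)⟩) ?_ ?_ ?_ ?_ ?_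
  · rintro ⟨⟨_, _⟩, ⟨_, _⟩⟩ hx
    simp only [Finset.mem_sigma, Finset.HasAntidiagonal.mem_antidiagonal] at hx ⊢
    exact ⟨by omega, trivial⟩
  · rintro ⟨⟨_, _⟩, ⟨_, _⟩⟩ hx
    simp only [Finset.mem_sigma, Finset.HasAntidiagonal.mem_antidiagonal] at hx ⊢
    exact ⟨by omega, trivial⟩
  · rintro ⟨⟨_, _⟩, ⟨_, _⟩⟩ hx
    simp only [Finset.mem_sigma, Finset.HasAntidiagonal.mem_antidiagonal] at hx
    obtain ⟨-, rfl⟩ := hx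
    rfl
  · rintro ⟨⟨_, _⟩, ⟨_, _⟩⟩ hx
    simp only [Finset.mem_sigma, Finset.HasAntidiagonal.mem_antidiagonal] at hx
    obtain ⟨-, rfl⟩ := hx
    rfl
  · rintro ⟨⟨_, _⟩, ⟨_, _⟩⟩ hx
    rfl

variable {F : Type*} [Field F] {a b c i j k m n : ℕ}

theorem A_induction {P : A F → Prop} (x : A F) (zero : P 0) (inc : ∀ n φ, P (incA F n φ))
    (add : ∀ x y, P x → P y → P (x + y)) : P x :=
  DirectSum.induction_on x zero inc add

theorem B_induction [StarRing F] {P : B F → Prop} (x : B F) (zero : P 0) (inc : ∀ n ψ, P (incB F n ψ))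
    (add : ∀ x y, P x → P y → P (x + y)) : P x :=
  DirectSum.induction_on x zero inc add

theorem counitA_incA_zero (φ : (glPair F 0).C) :
    counitA F (incA F 0 φ) = (φ : (glPair F 0).Lie → ℝ) 0 := by
  simp [counitA, incA, DirectSum.component.lof_self]

theorem counitA_incA_of_ne {m : ℕ} (hm : m ≠ 0) (φ : (glPair F m).C) :
    counitA F (incA F m φ) = 0 := by
  simp [counitA, incA, DirectSum.component.of, hm]

variable [Finite F]

theorem nabla_tmul (h : i + j = n) (φ : (glPair F i).C) (ψ : (glPair F j).C) :
    nabla F (incA F i φ ⊗ₜ incA F j ψ) =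
      incA F n ((glParabolic F h).ind (glParTensor F h (φ ⊗ₜ ψ))) := by
  subst h
  rw [nabla, LinearMap.comp_apply, LinearEquiv.coe_coe, incA, incA,
    TensorProduct.directSum_lof_tmul_lof, DirectSum.toModule_lof]
  rfl

theorem delta_incA (Φ : (glPair F n).C) :
    delta F (incA F n Φ) = ∑ p : Finset.HasAntidiagonal.antidiagonal n,
      TensorProduct.map (incA F p.1.1) (incA F p.1.2)
        (glRes F (Finset.HasAntidiagonal.mem_antidiagonal.mp p.2) Φ) := by
  rw [delta, incA, DirectSum.toModule_lof, LinearMap.sum_apply]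
  rfl

variable [StarRing F]

/-- The degree `n` is only required to equal `i + j`, so that both sides of associativity can be
placed in the same degree `a + b + c`. -/
theorem nablaB_tmul (h : i + j = n) (φ : (glPair F i).C) (ψ : (uPair F (2 * j)).C) :
    nablaB F (incA F i φ ⊗ₜ incB F j ψ) =
      incB F n ((uParabolic F h).ind (uParTensor F h (φ ⊗ₜ ψ))) := by
  subst h
  rw [nablaB, LinearMap.comp_apply, LinearEquiv.coe_coe, incA, incB,
    TensorProduct.directSum_lof_tmul_lof, DirectSum.toModule_lof]
  rfl

theorem deltaB_incB (Ψ : (uPair F (2 * n)).C) :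
    deltaB F (incB F n Ψ) = ∑ p : Finset.HasAntidiagonal.antidiagonal n,
      TensorProduct.map (incA F p.1.1) (incB F p.1.2)
        (uRes F (Finset.HasAntidiagonal.mem_antidiagonal.mp p.2) Ψ) := by
  rw [deltaB, incB, DirectSum.toModule_lof, LinearMap.sum_apply]
  rfl

theorem nablaB_mem_gradeB (n : ℕ) : gradeAB F n ≤ (gradeB F n).comap (nablaB F) := by
  refine iSup₂_le fun p hp => ?_
  rintro _ ⟨t, rfl⟩
  rw [Submodule.mem_comap]
  induction t with
  | zero => simp
  | add x y hx hy => rw [map_add, map_add]; exact add_mem hx hy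
  | tmul φ ψ =>
    rw [TensorProduct.map_tmul, nablaB_tmul (Finset.HasAntidiagonal.mem_antidiagonal.mp hp)]
    exact ⟨_, rfl⟩

theorem deltaB_mem_gradeAB (n : ℕ) (b : B F) (hb : b ∈ gradeB F n) :
    deltaB F b ∈ gradeAB F n := by
  obtain ⟨Ψ, rfl⟩ := hb
  rw [deltaB_incB]
  exact Submodule.sum_mem _ fun p _ =>
    Submodule.mem_iSup_of_mem p.1 (Submodule.mem_iSup_of_mem p.2 ⟨_, rfl⟩)

theorem nablaB_assoc (x y : A F) (z : B F) :
    nablaB F (nabla F (x ⊗ₜ y) ⊗ₜ z) = nablaB F (x ⊗ₜ nablaB F (y ⊗ₜ z)) := by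
  induction x using A_induction with
  | zero => simp
  | add x x' hx hx' => simp only [TensorProduct.add_tmul, map_add, hx, hx']
  | inc a φ =>
  induction y using A_induction with
  | zero => simp
  | add y y' hy hy' =>
    simp only [TensorProduct.add_tmul, TensorProduct.tmul_add, map_add, hy, hy']
  | inc b φ' =>
  induction z using B_induction with
  | zero => simp
  | add z z' hz hz' => simp only [TensorProduct.tmul_add, map_add, hz, hz']
  | inc c ψ =>
    rw [nabla_tmul rfl, nablaB_tmul rfl, nablaB_tmul rfl, nablaB_tmul (add_assoc a b c).symm,
      ind_ind rfl rfl rfl (add_assoc a b c).symm]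

theorem nablaB_unit (z : B F) : nablaB F (unitA F 1 ⊗ₜ z) = z := by
  induction z using B_induction with
  | zero => simp
  | add z z' hz hz' => simp only [TensorProduct.tmul_add, map_add, hz, hz']
  | inc n ψ =>
    rw [unitA, LinearMap.comp_apply, nablaB_tmul (zero_add n), ind_zero]
    exact congrArg (incB F n) (one_smul ℝ ψ)

theorem assoc_map_delta (t : (glPair F m).C ⊗[ℝ] (uPair F (2 * c)).C) :
    TensorProduct.assoc ℝ (A F) (A F) (B F) (TensorProduct.map (delta F) LinearMap.id
      (TensorProduct.map (incA F m) (incB F c) t)) =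
    ∑ q : Finset.HasAntidiagonal.antidiagonal m,
      TensorProduct.map (incA F q.1.1) (TensorProduct.map (incA F q.1.2) (incB F c))
        (TensorProduct.assoc ℝ _ _ _ (TensorProduct.map
          (glRes F (Finset.HasAntidiagonal.mem_antidiagonal.mp q.2)) LinearMap.id t)) :=
  assoc_map_map_of_sum (incA F m) (incB F c) (delta F)
    (fun q : Finset.HasAntidiagonal.antidiagonal m => incA F q.1.1) (fun q => incA F q.1.2)
    (fun q => glRes F (Finset.HasAntidiagonal.mem_antidiagonal.mp q.2)) delta_incA t

theorem map_id_deltaB (t : (glPair F a).C ⊗[ℝ] (uPair F (2 * k)).C) :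
    TensorProduct.map LinearMap.id (deltaB F) (TensorProduct.map (incA F a) (incB F k) t) =
    ∑ q : Finset.HasAntidiagonal.antidiagonal k,
      TensorProduct.map (incA F a) (TensorProduct.map (incA F q.1.1) (incB F q.1.2))
        (TensorProduct.map LinearMap.id
          (uRes F (Finset.HasAntidiagonal.mem_antidiagonal.mp q.2)) t) :=
  map_map_of_sum (incA F a) (incB F k) (deltaB F)
    (fun q : Finset.HasAntidiagonal.antidiagonal k => incA F q.1.1) (fun q => incB F q.1.2)
    (fun q => uRes F (Finset.HasAntidiagonal.mem_antidiagonal.mp q.2)) deltaB_incB t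

/-- On a homogeneous element both sides are sums over triples `a + b + c = n`, and `uRes_coassoc`
identifies the terms. -/
theorem deltaB_coassoc (z : B F) :
    TensorProduct.assoc ℝ (A F) (A F) (B F)
        (TensorProduct.map (delta F) LinearMap.id (deltaB F z)) =
      TensorProduct.map LinearMap.id (deltaB F) (deltaB F z) := by
  induction z using B_induction with
  | zero => simp only [LinearMap.map_zero, LinearEquiv.map_zero]
  | add z z' hz hz' => simp only [LinearMap.map_add, LinearEquiv.map_add, hz, hz']
  | inc n Ψ =>
    -- The component of index `(a, b, c)`. The value `0` off `a + b + c = n` only makes `T` total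
    -- and never enters the sums; `hT` and `hT'` give its two expressions.
    let T : ℕ → ℕ → ℕ → A F ⊗[ℝ] (A F ⊗[ℝ] B F) := fun a b c => if h : a + b + c = n then
      TensorProduct.map (incA F a) (TensorProduct.map (incA F b) (incB F c))
        (TensorProduct.assoc ℝ _ _ _
          (TensorProduct.map (glRes F rfl) LinearMap.id (uRes F h Ψ))) else 0
    have hT : ∀ (a b c m : ℕ) (hm : a + b = m) (h : m + c = n), T a b c =
        TensorProduct.map (incA F a) (TensorProduct.map (incA F b) (incB F c))
          (TensorProduct.assoc ℝ _ _ _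
            (TensorProduct.map (glRes F hm) LinearMap.id (uRes F h Ψ))) := by
      intro a b c m hm h
      subst hm
      exact dif_pos h
    have hT' : ∀ (a b c k : ℕ) (hk : b + c = k) (h : a + k = n), T a b c =
        TensorProduct.map (incA F a) (TensorProduct.map (incA F b) (incB F c))
          (TensorProduct.map LinearMap.id (uRes F hk) (uRes F h Ψ)) := by
      intro a b c k hk h
      rw [hT a b c _ rfl (by omega), uRes_coassoc rfl (by omega) hk h]
    trans ∑ p ∈ Finset.HasAntidiagonal.antidiagonal n,
      ∑ q ∈ Finset.HasAntidiagonal.antidiagonal p.1, T q.1 q.2 p.2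
    · rw [deltaB_incB, map_sum, map_sum]
      refine Eq.trans (Finset.sum_congr rfl fun p _ => ?_) (Finset.sum_coe_sort _
        fun p : ℕ × ℕ => ∑ q ∈ Finset.HasAntidiagonal.antidiagonal p.1, T q.1 q.2 p.2)
      refine (assoc_map_delta _).trans ?_
      refine Eq.trans (Finset.sum_congr rfl fun q _ => ?_) (Finset.sum_coe_sort _
        fun q : ℕ × ℕ => T q.1 q.2 p.1.2)
      exact (hT _ _ _ _ _ _).symm
    · rw [sum_antidiagonal_antidiagonal_fst, deltaB_incB, map_sum]
      symm
      refine Eq.trans (Finset.sum_congr rfl fun p _ => ?_) (Finset.sum_coe_sort _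
        fun p : ℕ × ℕ => ∑ q ∈ Finset.HasAntidiagonal.antidiagonal p.2, T p.1 q.1 q.2)
      refine (map_id_deltaB _).trans ?_
      refine Eq.trans (Finset.sum_congr rfl fun q _ => ?_) (Finset.sum_coe_sort _
        fun q : ℕ × ℕ => T p.1.1 q.1 q.2)
      exact (hT' _ _ _ _ _ _).symm

theorem deltaB_counit (z : B F) :
    TensorProduct.lid ℝ (B F) (TensorProduct.map (counitA F) LinearMap.id (deltaB F z)) = z := by
  induction z using B_induction with
  | zero => simp
  | add z z' hz hz' => simp only [map_add, hz, hz']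
  | inc n Ψ =>
    rw [deltaB_incB, map_sum, map_sum, Finset.sum_eq_single ⟨(0, n), Finset.HasAntidiagonal.mem_antidiagonal.mpr (zero_add n)⟩]
    -- In the surviving term `(0, n)` the counit is evaluation at the only point of `𝔤𝔩(0)`, and
    -- `res_zero` says that this restriction changes nothing.
    · have key : ∀ t : (glPair F 0).C ⊗[ℝ] (uPair F (2 * n)).C,
          TensorProduct.lid ℝ (B F) (TensorProduct.map (counitA F) LinearMap.id
            (TensorProduct.map (incA F 0) (incB F n) t)) =
          incB F n (evalLeft (glPair F 0) _ 0 t) := by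
        intro t
        induction t with
        | zero => simp
        | add x y hx hy => simp only [map_add, hx, hy]
        | tmul φ ψ => simp [evalLeft_tmul, counitA_incA_zero]
      rw [key]
      congr 1
      apply Subtype.ext
      funext Y
      rw [evalLeft_uRes, res_zero]
    · rintro ⟨⟨m, c⟩, hp⟩ - hne
      have hm : m ≠ 0 := by
        rintro rfl
        have := Finset.HasAntidiagonal.mem_antidiagonal.mp hp
        simp only [zero_add] at this
        exact hne (by subst this; rfl)
      -- The terms with `m ≠ 0` vanish whatever the restriction is, because the counit kills
      -- positive degree.
      generalize uRes F _ Ψ = t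
      induction t with
      | zero => simp
      | add x y hx hy => simp only [map_add, hx, hy, add_zero]
      | tmul φ ψ => simp [counitA_incA_of_ne hm]
    · intro h
      exact absurd (Finset.mem_univ _) h

end Graded

end

end LieInv

theorem mainTheorem3 (q : ℕ) (hq : Odd q) (F : Type*) [Field F] [Fintype F]
    (hF : Fintype.card F = q ^ 2) :
    letI : StarRing F := LieInv.frobeniusStarRing q F hF
    -- the maps preserve the grading
    (∀ n, ∀ t ∈ LieInv.gradeAB F n, LieInv.nablaB F t ∈ LieInv.gradeB F n) ∧
    (∀ n, ∀ b ∈ LieInv.gradeB F n, LieInv.deltaB F b ∈ LieInv.gradeAB F n) ∧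
    -- associativity and unitality of the action
    (∀ (a a' : LieInv.A F) (b : LieInv.B F),
      LieInv.nablaB F (LieInv.nabla F (a ⊗ₜ[ℝ] a') ⊗ₜ[ℝ] b) =
        LieInv.nablaB F (a ⊗ₜ[ℝ] LieInv.nablaB F (a' ⊗ₜ[ℝ] b))) ∧
    (∀ b : LieInv.B F, LieInv.nablaB F (LieInv.unitA F 1 ⊗ₜ[ℝ] b) = b) ∧
    -- coassociativity and counitality of the coaction
    (∀ b : LieInv.B F,
      TensorProduct.assoc ℝ (LieInv.A F) (LieInv.A F) (LieInv.B F)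
          (TensorProduct.map (LieInv.delta F) LinearMap.id (LieInv.deltaB F b)) =
        TensorProduct.map LinearMap.id (LieInv.deltaB F) (LieInv.deltaB F b)) ∧
    (∀ b : LieInv.B F,
      TensorProduct.lid ℝ (LieInv.B F)
        (TensorProduct.map (LieInv.counitA F) LinearMap.id (LieInv.deltaB F b)) = b) := by
  let _ : StarRing F := LieInv.frobeniusStarRing q F hF
  exact ⟨fun n t ht => LieInv.nablaB_mem_gradeB n ht, LieInv.deltaB_mem_gradeAB,
    LieInv.nablaB_assoc, LieInv.nablaB_unit, LieInv.deltaB_coassoc, LieInv.deltaB_counit⟩
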